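/- Setting. Fix a finite set of sorts $\Gamma$, a variety $\Theta$ of $\Gamma$-sorted algebras (given by a signature and a set of identities; all algebras have non-empty carriers in every sort), and a $\Gamma$-sorted set $X^0$ of variables, infinite in every sort. A place is a finite subset $X\subset X^0$ for which the free algebra $W(X)$ of $\Theta$ has a non-empty carrier in every sort. For $G\in\Theta$, the points over $X$ are the elements of $\mathrm{Hom}(W(X),G)$. Let $\mathrm{Hal}_\Theta(G)$ be the many-sorted algebra whose carrier at the place $X$ is the set of all subsets of $\mathrm{Hom}(W(X),G)$, with the Boolean operations, the quantifiers $\exists x$ ($x\in X$; $\mu\in\exists x A$ iff $\mu$ agrees on $X\setminus\{x\}$ with some $\nu\in A$), the equalities $w\equiv w'$ ($w,w'\in W(X)$ of one sort; the set of all $\mu$ with $\mu(w)=\mu(w')$), and, for each homomorphism $s:W(X)\to W(Y)$, the operation $s_*A=\{\nu\in\mathrm{Hom}(W(Y),G)\mid \nu s\in A\}$. Let $\Phi$ be a set of symbols of relations with types in $\Gamma$, and let $f$ be a realization of $\Phi$ in $G$. Let $\mathrm{Hal}_{\Phi\Theta}$ be the algebra of formulas: the absolutely free algebra in this signature over the atomic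 formulas $\varphi(w_1,\dots,w_n)$, $\varphi\in\Phi$, modulo the congruence generated by the identities of Halmos algebras and by the relations $s\varphi(w_1,\dots,w_n)=\varphi(sw_1,\dots,sw_n)$. Let $\mathrm{Val}_f:\mathrm{Hal}_{\Phi\Theta}\to\mathrm{Hal}_\Theta(G)$ be the homomorphism sending $\varphi(w_1,\dots,w_n)$ to the set of all $\mu$ for which $(\mu(w_1),\dots,\mu(w_n))$ satisfies the relation $\varphi$ in the model $(G,\Phi,f)$, and let $R_f$ be its image. For a set $T\subset\mathrm{Hal}_{\Phi\Theta}(X)$ put $T^f=\bigcap_{u\in T}\mathrm{Val}_f(u)$. The (weak) category $K_{\Phi\Theta}(f)$ has as objects the pairs $(X,A)$ with $A=T^f$ for some $T\subset\mathrm{Hal}_{\Phi\Theta}(X)$, and as morphisms $(X,A)\to(Y,B)$ the homomorphisms $s:W(Y)\to W(X)$ such that $\nu s\in B$ for all $\nu\in A$. A multimodel $(G,\Phi,F)$ consists of an algebra $G\in\Theta$, a set $\Phi$ of symbols of relations and a set $F$ of realizations $f$ of $\Phi$ in $G$ (instances). Its knowledge base $KB(G,\Phi,F)$ is the category whose objects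 are the mappings $\mathrm{Val}_f:\mathrm{Hal}_{\Phi\Theta}\to K_{\Phi\Theta}(f)$, $f\in F$, and whose morphisms from $f_1$ to $f_2$ are the functors $\gamma:K_{\Phi\Theta}(f_1)\to K_{\Phi\Theta}(f_2)$ with $\gamma(T^{f_1})=T^{f_2}$ for every set $T$ of formulas of one place. Two knowledge bases $KB_1=KB(G_1,\Phi_1,F_1)$ and $KB_2=KB(G_2,\Phi_2,F_2)$ are equivalent if there are a bijection $\alpha:F_1\to F_2$ and, for every $f\in F_1$, an isomorphism of categories $\gamma_f:K_{\Phi_1\Theta}(f)\to K_{\Phi_2\Theta}(f^\alpha)$ that preserves the place $X$, preserves and reflects inclusions of algebraic sets, and induces an isomorphism of algebras $R_f\to R_{f^\alpha}$. If $\Phi_1=\Phi_2$, then $KB_1$ and $KB_2$ are isomorphic if there is such a pair $(\alpha,\gamma)$ in which every $\gamma_f$ is correct, that is, $\gamma_f\mathrm{Val}_f=\mathrm{Val}_{f^\alpha}$, and which gives an isomorphism of the categories $KB_1$ and $KB_2$ by $f\mapsto f^\alpha$ and $\gamma\mapsto\gamma_{f_2}\gamma\gamma_{f_1}^{-1}$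 for $\gamma$ from $f_1$ to $f_2$. The multimodels $(G_1,\Phi_1,F_1)$ and $(G_2,\Phi_2,F_2)$ are automorphic equivalent if there is a bijection $\alpha:F_1\to F_2$ such that for every $f\in F_1$ there is an isomorphism of algebras $\delta:G_2\to G_1$ with $\mathrm{Aut}(f^\alpha)=\delta^{-1}\mathrm{Aut}(f)\,\delta$, where $\mathrm{Aut}(f)\subset\mathrm{Aut}(G)$ is the group of automorphisms of the model $(G,\Phi,f)$. If $\Phi_1=\Phi_2=\Phi$, they are isomorphic if there is a bijection $\alpha:F_1\to F_2$ such that for every $f\in F_1$ the models $(G_1,\Phi,f)$ and $(G_2,\Phi,f^\alpha)$ are isomorphic. Theorem. Let $G_1,G_2\in\Theta$ be finite algebras. (1) For all multimodels $(G_1,\Phi_1,F_1)$ and $(G_2,\Phi_2,F_2)$, the knowledge bases $KB_1$ and $KB_2$ are equivalent if and only if the multimodels are automorphic equivalent. (2) For all multimodels $(G_1,\Phi,F_1)$ and $(G_2,\Phi,F_2)$ with the same $\Phi$, the knowledge bases $KB_1$ and $KB_2$ are isomorphic if and only if the multimodels are isomorphic. -/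

import Mathlib

open CategoryTheory

universe u v a b b₁ b₂ w w₁ w₂

namespace KnowledgeBase

/-! ### Many-sorted algebras and varieties -/

/-- A signature of `Γ`-sorted operations: the operation `o` has the type
`(i₁, …, iₙ; j)`, where `dom o = [i₁, …, iₙ]` and `cod o = j`. -/
structure Signature (Γ : Type u) where
  Op : Type a
  dom : Op → List Γ
  cod : Op → Γ

/-- Tuples in `G_{i₁} × ⋯ × G_{iₙ}` for `l = [i₁, …, iₙ]`. -/
abbrev Tuple {Γ : Type u} (G : Γ → Type w) (l : List Γ) : Type w :=
  ∀ k : Fin l.length, G (l.get k)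

/-- Terms over a many-sorted set of variables, given as its disjoint union `V` with the sort
map `srt`. -/
inductive Term {Γ : Type u} (S : Signature.{u, a} Γ) {V : Type v} (srt : V → Γ) :
    Γ → Type (max u v a)
  | var (x : V) : Term S srt (srt x)
  | app (o : S.Op) (t : ∀ k : Fin (S.dom o).length, Term S srt ((S.dom o).get k)) :
      Term S srt (S.cod o)

/-- The value of a term under an assignment `e` of its variables. -/
def Term.eval {Γ : Type u} {S : Signature.{u, a} Γ} {V : Type v} {srt : V → Γ}
    {G : Γ → Type w} (op : ∀ o : S.Op, Tuple G (S.dom o) → G (S.cod o))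
    (e : ∀ x : V, G (srt x)) : ∀ {i : Γ}, Term S srt i → G i
  | _, .var x => e x
  | _, .app o t => op o fun k => (t k).eval op e

/-- Substitution of terms for variables. -/
abbrev Term.bind {Γ : Type u} {S : Signature.{u, a} Γ} {V V' : Type v} {srt : V → Γ}
    {srt' : V' → Γ} (e : ∀ x : V, Term S srt' (srt x)) {i : Γ} (t : Term S srt i) :
    Term S srt' i :=
  t.eval Term.app e

/-- A variety of `Γ`-sorted algebras: a signature and a set of identities, written in a fixed
many-sorted set `Var` of variables, infinite in every sort. -/
structure Variety (Γ : Type u) extends Signature.{u, a} Γ where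
  Var : Type v
  srt : Var → Γ
  infinite_var : ∀ i, (srt ⁻¹' {i}).Infinite
  ids : ∀ i, Set (Term toSignature srt i × Term toSignature srt i)

variable {Γ : Type u}

/-- Algebras of the variety `Θ`, with non-empty carriers. -/
structure Alg (Θ : Variety.{u, v, a} Γ) where
  carrier : Γ → Type w
  nonempty : ∀ i, Nonempty (carrier i)
  op : ∀ o : Θ.Op, Tuple carrier (Θ.dom o) → carrier (Θ.cod o)
  sat : ∀ i, ∀ p ∈ Θ.ids i, ∀ e : ∀ x : Θ.Var, carrier (Θ.srt x),
    p.1.eval op e = p.2.eval op e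

instance (Θ : Variety.{u, v, a} Γ) : CoeFun (Alg.{u, v, a, w} Θ) fun _ => Γ → Type w :=
  ⟨Alg.carrier⟩

variable {Θ : Variety.{u, v, a} Γ}

/-- Homomorphisms of algebras. -/
@[ext]
structure Hom (G : Alg.{u, v, a, w₁} Θ) (H : Alg.{u, v, a, w₂} Θ) where
  toFun : ∀ i, G i → H i
  map_op : ∀ (o : Θ.Op) (t : Tuple G (Θ.dom o)),
    toFun _ (G.op o t) = H.op o fun k => toFun _ (t k)

/-- The identity homomorphism. -/
def Hom.id (G : Alg.{u, v, a, w} Θ) : Hom G G where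
  toFun _ g := g
  map_op _ _ := rfl

/-- The composite `ν s` (first `s`, then `ν`). -/
def Hom.comp {G : Alg.{u, v, a, w} Θ} {H : Alg.{u, v, a, w₁} Θ} {K : Alg.{u, v, a, w₂} Θ}
    (ν : Hom H K) (s : Hom G H) : Hom G K where
  toFun i g := ν.toFun i (s.toFun i g)
  map_op o t := by rw [s.map_op, ν.map_op]

/-- Isomorphisms of algebras. -/
structure Iso (G : Alg.{u, v, a, w₁} Θ) (H : Alg.{u, v, a, w₂} Θ) where
  toEquiv : ∀ i, G i ≃ H i
  map_op : ∀ (o : Θ.Op) (t : Tuple G (Θ.dom o)),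
    toEquiv _ (G.op o t) = H.op o fun k => toEquiv _ (t k)

/-- The inverse isomorphism. -/
def Iso.symm {G : Alg.{u, v, a, w₁} Θ} {H : Alg.{u, v, a, w₂} Θ} (δ : Iso G H) : Iso H G where
  toEquiv i := (δ.toEquiv i).symm
  map_op o t := by
    rw [Equiv.symm_apply_eq, δ.map_op]
    simp

/-- The composite of isomorphisms: first `δ`, then `ε`. -/
def Iso.trans {G : Alg.{u, v, a, w} Θ} {H : Alg.{u, v, a, w₁} Θ} {K : Alg.{u, v, a, w₂} Θ}
    (δ : Iso G H) (ε : Iso H K) : Iso G K where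
  toEquiv i := (δ.toEquiv i).trans (ε.toEquiv i)
  map_op o t := by simp [δ.map_op, ε.map_op]

/-! ### Free algebras -/

/-- The fully invariant congruence of the term algebra defined by the identities of `Θ`. -/
inductive TermEq (Θ : Variety.{u, v, a} Γ) {V : Type v} {srt : V → Γ} :
    ∀ {i : Γ}, Term Θ.toSignature srt i → Term Θ.toSignature srt i → Prop
  | refl {i : Γ} (t : Term Θ.toSignature srt i) : TermEq Θ t t
  | symm {i : Γ} {t t' : Term Θ.toSignature srt i} : TermEq Θ t t' → TermEq Θ t' t
  | trans {i : Γ} {t t' t'' : Term Θ.toSignature srt i} :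
      TermEq Θ t t' → TermEq Θ t' t'' → TermEq Θ t t''
  | app (o : Θ.Op)
      (t t' : ∀ k : Fin (Θ.dom o).length, Term Θ.toSignature srt ((Θ.dom o).get k)) :
      (∀ k, TermEq Θ (t k) (t' k)) → TermEq Θ (.app o t) (.app o t')
  | ax {i : Γ} (p : Term Θ.toSignature Θ.srt i × Term Θ.toSignature Θ.srt i)
      (e : ∀ x : Θ.Var, Term Θ.toSignature srt (Θ.srt x)) :
      p ∈ Θ.ids i → TermEq Θ (p.1.bind e) (p.2.bind e)

/-- Finite many-sorted sets `X` of variables whose free algebra `W(X)` has non-empty carriers.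
These are the types of formulas. -/
structure Place (Θ : Variety.{u, v, a} Γ) where
  vars : Finset Θ.Var
  nonempty : ∀ i, Nonempty (Term Θ.toSignature (fun x : {x // x ∈ vars} => Θ.srt x.1) i)

/-- The variables that belong to `X`. -/
abbrev Place.V (X : Place Θ) : Type v := {x // x ∈ X.vars}

/-- The sort of a variable in `X`. -/
abbrev Place.srt (X : Place Θ) : X.V → Γ := fun x => Θ.srt x.1

/-- `TermEq` as a setoid. -/
def termSetoid (X : Place Θ) (i : Γ) : Setoid (Term Θ.toSignature X.srt i) where
  r := TermEq Θ
  iseqv := ⟨.refl, .symm, .trans⟩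

/-- The operations of the free algebra. -/
noncomputable def freeOp (X : Place Θ) (o : Θ.Op)
    (t : Tuple (fun i => Quotient (termSetoid X i)) (Θ.dom o)) :
    Quotient (termSetoid X (Θ.cod o)) :=
  Quotient.mk _ (Term.app o fun k => (t k).out)

theorem freeOp_mk (X : Place Θ) (o : Θ.Op)
    (t : ∀ k : Fin (Θ.dom o).length, Term Θ.toSignature X.srt ((Θ.dom o).get k)) :
    freeOp X o (fun k => Quotient.mk _ (t k)) = Quotient.mk _ (Term.app o t) :=
  Quotient.sound (TermEq.app o _ _ fun k => Quotient.mk_out (s := termSetoid X _) (t k))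

theorem eval_freeOp (X : Place Θ) {V : Type v} {srt : V → Γ}
    (e : ∀ x : V, Term Θ.toSignature X.srt (srt x)) {i : Γ} (t : Term Θ.toSignature srt i) :
    t.eval (freeOp X) (fun x => Quotient.mk (termSetoid X _) (e x)) =
      Quotient.mk (termSetoid X i) (t.bind e) := by
  induction t with
  | var x => rfl
  | app o t ih =>
    simp only [Term.eval, ih]
    exact freeOp_mk X o _

/-- The free algebra `W(X)` of the variety `Θ`. -/
noncomputable def W (X : Place Θ) : Alg.{u, v, a, max u v a} Θ where
  carrier i := Quotient (termSetoid X i)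
  nonempty i := (X.nonempty i).map (Quotient.mk _)
  op := freeOp X
  sat i p hp e := by
    have he : e = fun x => Quotient.mk (termSetoid X _) (e x).out := by
      funext x; exact (Quotient.out_eq _).symm
    rw [he, eval_freeOp, eval_freeOp]
    exact Quotient.sound (TermEq.ax p _ hp)

/-- The free generators of `W(X)`. -/
def gen (X : Place Θ) (x : X.V) : W X (X.srt x) :=
  Quotient.mk (termSetoid X _) (Term.var x)

theorem eval_sound (G : Alg.{u, v, a, w} Θ) {V : Type v} {srt : V → Γ}
    (e : ∀ x : V, G (srt x)) {i : Γ} {t t' : Term Θ.toSignature srt i} (h : TermEq Θ t t') :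
    t.eval G.op e = t'.eval G.op e := by
  induction h with
  | refl => rfl
  | symm _ ih => exact ih.symm
  | trans _ _ ih₁ ih₂ => exact ih₁.trans ih₂
  | app o t t' _ ih => simp only [Term.eval, ih]
  | ax p σ hp =>
    have key : ∀ {j : Γ} (s : Term Θ.toSignature Θ.srt j),
        (s.bind σ).eval G.op e = s.eval G.op (fun x => (σ x).eval G.op e) := by
      intro j s
      induction s with
      | var x => rfl
      | app o s ih => simp only [Term.bind, Term.eval] at ih ⊢; simp only [ih]
    rw [key, key]
    exact G.sat _ p hp _

/-- The homomorphism `W(X) → G` that extends a mapping `X → G`. -/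
def lift {X : Place Θ} {G : Alg.{u, v, a, w} Θ} (e : ∀ x : X.V, G (X.srt x)) : Hom (W X) G where
  toFun i := Quotient.lift (fun t => t.eval G.op e) fun _ _ h => eval_sound G e h
  map_op o t := by
    change Term.eval _ _ (Term.app _ _) = _
    simp only [Term.eval]
    congr 1
    funext k
    conv_rhs => rw [← Quotient.out_eq (t k)]
    rfl

@[simp]
theorem lift_gen {X : Place Θ} {G : Alg.{u, v, a, w} Θ} (e : ∀ x : X.V, G (X.srt x)) (x : X.V) :
    (lift e).toFun _ (gen X x) = e x := rfl

theorem hom_ext {X : Place Θ} {G : Alg.{u, v, a, w} Θ} {μ ν : Hom (W X) G}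
    (h : ∀ x, μ.toFun _ (gen X x) = ν.toFun _ (gen X x)) : μ = ν := by
  have key : ∀ {i : Γ} (t : Term Θ.toSignature X.srt i),
      μ.toFun i (Quotient.mk _ t) = ν.toFun i (Quotient.mk _ t) := by
    intro i t
    induction t with
    | var x => exact h x
    | app o t ih =>
      have e := freeOp_mk X o t
      rw [← e]
      refine (μ.map_op o _).trans (Eq.trans ?_ (ν.map_op o _).symm)
      simp only [ih]
  ext i q
  obtain ⟨t, rfl⟩ := Quotient.exists_rep q
  exact key t

/-- The elements of `W(X)` outside whose support the variable `y` lies: the subalgebra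
generated by the other variables. -/
inductive Avoids {X : Place Θ} (y : X.V) : ∀ {i : Γ}, W X i → Prop
  | gen (x : X.V) : x ≠ y → Avoids y (gen X x)
  | op (o : Θ.Op) (t : Tuple (W X) (Θ.dom o)) : (∀ k, Avoids y (t k)) → Avoids y ((W X).op o t)

theorem Avoids.congr {X : Place Θ} {y : X.V} {G : Alg.{u, v, a, w} Θ} {μ ν : Hom (W X) G}
    (h : ∀ x, x ≠ y → μ.toFun _ (KnowledgeBase.gen X x) = ν.toFun _ (KnowledgeBase.gen X x))
    {i : Γ} {q : W X i} (hq : Avoids y q) : μ.toFun i q = ν.toFun i q := by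
  induction hq with
  | gen x hx => exact h x hx
  | op o t _ ih => rw [μ.map_op, ν.map_op]; simp only [ih]

open Classical in
/-- The endomorphism `s^x_w` of `W(X)`: it sends `x` to `w` and fixes the other variables. -/
noncomputable def single {X : Place Θ} (x : X.V) (w : W X (X.srt x)) : Hom (W X) (W X) :=
  lift (Function.update (gen X) x w)

/-! ### Algebras in the signature of many-sorted first order logic over `Θ` -/

/-- Algebras with one carrier for every place, with Boolean operations, quantifiers, equalities
and an operation for every homomorphism `s : W(X) → W(Y)`. -/
structure LAlg (Θ : Variety.{u, v, a} Γ) where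
  carrier : Place Θ → Type w
  bot : ∀ X, carrier X
  top : ∀ X, carrier X
  sup : ∀ {X}, carrier X → carrier X → carrier X
  inf : ∀ {X}, carrier X → carrier X → carrier X
  compl : ∀ {X}, carrier X → carrier X
  ex : ∀ {X : Place Θ}, X.V → carrier X → carrier X
  eq : ∀ {X : Place Θ} {i : Γ}, W X i → W X i → carrier X
  sub : ∀ {X Y : Place Θ}, Hom (W X) (W Y) → carrier X → carrier Y

/-- Isomorphisms of such algebras. -/
structure LAlg.Iso (R : LAlg.{u, v, a, w₁} Θ) (R' : LAlg.{u, v, a, w₂} Θ) where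
  toEquiv : ∀ X, R.carrier X ≃ R'.carrier X
  map_bot : ∀ X, toEquiv X (R.bot X) = R'.bot X
  map_top : ∀ X, toEquiv X (R.top X) = R'.top X
  map_sup : ∀ {X} (A B : R.carrier X), toEquiv X (R.sup A B) = R'.sup (toEquiv X A) (toEquiv X B)
  map_inf : ∀ {X} (A B : R.carrier X), toEquiv X (R.inf A B) = R'.inf (toEquiv X A) (toEquiv X B)
  map_compl : ∀ {X} (A : R.carrier X), toEquiv X (R.compl A) = R'.compl (toEquiv X A)
  map_ex : ∀ {X : Place Θ} (x : X.V) (A : R.carrier X),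
    toEquiv X (R.ex x A) = R'.ex x (toEquiv X A)
  map_eq : ∀ {X : Place Θ} {i : Γ} (p q : W X i), toEquiv X (R.eq p q) = R'.eq p q
  map_sub : ∀ {X Y : Place Θ} (s : Hom (W X) (W Y)) (A : R.carrier X),
    toEquiv Y (R.sub s A) = R'.sub s (toEquiv X A)

/-- The affine space `Hom(W(X), G)`. -/
abbrev Point (X : Place Θ) (G : Alg.{u, v, a, w} Θ) := Hom (W X) G

/-- The quantifier `∃x` on sets of points. -/
def exSet {X : Place Θ} {G : Alg.{u, v, a, w} Θ} (x : X.V) (A : Set (Point X G)) :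
    Set (Point X G) :=
  {μ | ∃ ν ∈ A, ∀ y, y ≠ x → μ.toFun _ (gen X y) = ν.toFun _ (gen X y)}

/-- The equality `p ≡ q` as a set of points. -/
def eqSet {X : Place Θ} (G : Alg.{u, v, a, w} Θ) {i : Γ} (p q : W X i) : Set (Point X G) :=
  {μ | μ.toFun _ p = μ.toFun _ q}

/-- The operation `s_*` on sets of points. -/
def subSet {X Y : Place Θ} {G : Alg.{u, v, a, w} Θ} (s : Hom (W X) (W Y))
    (A : Set (Point X G)) : Set (Point Y G) :=
  {ν | ν.comp s ∈ A}

/-- The Halmos algebra `Hal_Θ(G)` of all sets of points of the affine spaces over `G`. -/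
def HalG (G : Alg.{u, v, a, w} Θ) : LAlg Θ where
  carrier X := Set (Point X G)
  bot _ := ∅
  top _ := Set.univ
  sup A B := A ∪ B
  inf A B := A ∩ B
  compl A := Aᶜ
  ex x A := exSet x A
  eq p q := eqSet G p q
  sub s A := subSet s A

/-! ### Formulas and their values -/

/-- A set of symbols of relations with their types. -/
structure RelSig (Γ : Type u) where
  Rel : Type b
  arity : Rel → List Γ

/-- Realizations of the symbols in the algebra `G`; `(G, Φ, f)` is a model. -/
abbrev Realization (Φ : RelSig.{u, b} Γ) (G : Alg.{u, v, a, w} Θ) :=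
  ∀ r : Φ.Rel, Set (Tuple G (Φ.arity r))

/-- Pure formulas: the absolutely free algebra over the atomic formulas. -/
inductive Formula (Θ : Variety.{u, v, a} Γ) (Φ : RelSig.{u, b} Γ) :
    Place Θ → Type (max u v a b)
  | rel {X : Place Θ} (r : Φ.Rel) (t : Tuple (W X) (Φ.arity r)) : Formula Θ Φ X
  | bot (X : Place Θ) : Formula Θ Φ X
  | top (X : Place Θ) : Formula Θ Φ X
  | sup {X : Place Θ} (p q : Formula Θ Φ X) : Formula Θ Φ X
  | inf {X : Place Θ} (p q : Formula Θ Φ X) : Formula Θ Φ X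
  | compl {X : Place Θ} (p : Formula Θ Φ X) : Formula Θ Φ X
  | ex {X : Place Θ} (x : X.V) (p : Formula Θ Φ X) : Formula Θ Φ X
  | eq {X : Place Θ} {i : Γ} (p q : W X i) : Formula Θ Φ X
  | sub {X Y : Place Θ} (s : Hom (W X) (W Y)) (p : Formula Θ Φ X) : Formula Θ Φ Y

/-- The value of a pure formula in the model `(G, Φ, f)`. -/
def Formula.val {Φ : RelSig.{u, b} Γ} {G : Alg.{u, v, a, w} Θ} (f : Realization Φ G) :
    ∀ {X : Place Θ}, Formula Θ Φ X → Set (Point X G)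
  | _, .rel r t => {μ | (fun k => μ.toFun _ (t k)) ∈ f r}
  | _, .bot _ => ∅
  | _, .top _ => Set.univ
  | _, .sup p q => p.val f ∪ q.val f
  | _, .inf p q => p.val f ∩ q.val f
  | _, .compl p => (p.val f)ᶜ
  | _, .ex x p => exSet x (p.val f)
  | _, .eq p q => eqSet G p q
  | _, .sub s p => subSet s (p.val f)

/-- Finite conjunctions. -/
def Formula.conj {Φ : RelSig.{u, b} Γ} {X : Place Θ} : List (Formula Θ Φ X) → Formula Θ Φ X
  | [] => .top X
  | p :: l => .inf p (conj l)

/-- The congruence on pure formulas generated by the identities of Halmos algebras and by the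
relations `s φ(w₁, …, wₙ) = φ(s w₁, …, s wₙ)`. An inequality `p ≤ q` is written as
`p ⊓ q = p`. -/
inductive FormulaEq (Θ : Variety.{u, v, a} Γ) (Φ : RelSig.{u, b} Γ) :
    ∀ {X : Place Θ}, Formula Θ Φ X → Formula Θ Φ X → Prop
  -- congruence
  | refl {X : Place Θ} (p : Formula Θ Φ X) : FormulaEq Θ Φ p p
  | symm {X : Place Θ} {p q : Formula Θ Φ X} : FormulaEq Θ Φ p q → FormulaEq Θ Φ q p
  | trans {X : Place Θ} {p q r : Formula Θ Φ X} :
      FormulaEq Θ Φ p q → FormulaEq Θ Φ q r → FormulaEq Θ Φ p r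
  | sup {X : Place Θ} {p p' q q' : Formula Θ Φ X} :
      FormulaEq Θ Φ p p' → FormulaEq Θ Φ q q' → FormulaEq Θ Φ (.sup p q) (.sup p' q')
  | inf {X : Place Θ} {p p' q q' : Formula Θ Φ X} :
      FormulaEq Θ Φ p p' → FormulaEq Θ Φ q q' → FormulaEq Θ Φ (.inf p q) (.inf p' q')
  | compl {X : Place Θ} {p p' : Formula Θ Φ X} :
      FormulaEq Θ Φ p p' → FormulaEq Θ Φ (.compl p) (.compl p')
  | ex {X : Place Θ} (x : X.V) {p p' : Formula Θ Φ X} :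
      FormulaEq Θ Φ p p' → FormulaEq Θ Φ (.ex x p) (.ex x p')
  | sub {X Y : Place Θ} (s : Hom (W X) (W Y)) {p p' : Formula Θ Φ X} :
      FormulaEq Θ Φ p p' → FormulaEq Θ Φ (.sub s p) (.sub s p')
  -- Boolean algebras
  | sup_comm {X : Place Θ} (p q : Formula Θ Φ X) : FormulaEq Θ Φ (.sup p q) (.sup q p)
  | inf_comm {X : Place Θ} (p q : Formula Θ Φ X) : FormulaEq Θ Φ (.inf p q) (.inf q p)
  | sup_assoc {X : Place Θ} (p q r : Formula Θ Φ X) :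
      FormulaEq Θ Φ (.sup (.sup p q) r) (.sup p (.sup q r))
  | inf_assoc {X : Place Θ} (p q r : Formula Θ Φ X) :
      FormulaEq Θ Φ (.inf (.inf p q) r) (.inf p (.inf q r))
  | sup_inf_self {X : Place Θ} (p q : Formula Θ Φ X) : FormulaEq Θ Φ (.sup p (.inf p q)) p
  | inf_sup_self {X : Place Θ} (p q : Formula Θ Φ X) : FormulaEq Θ Φ (.inf p (.sup p q)) p
  | inf_sup_distrib {X : Place Θ} (p q r : Formula Θ Φ X) :
      FormulaEq Θ Φ (.inf p (.sup q r)) (.sup (.inf p q) (.inf p r))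
  | sup_compl {X : Place Θ} (p : Formula Θ Φ X) : FormulaEq Θ Φ (.sup p (.compl p)) (.top X)
  | inf_compl {X : Place Θ} (p : Formula Θ Φ X) : FormulaEq Θ Φ (.inf p (.compl p)) (.bot X)
  -- quantifiers
  | ex_bot {X : Place Θ} (x : X.V) : FormulaEq Θ Φ (.ex x (.bot X)) (.bot X)
  | le_ex {X : Place Θ} (x : X.V) (p : Formula Θ Φ X) : FormulaEq Θ Φ (.inf p (.ex x p)) p
  | ex_inf_ex {X : Place Θ} (x : X.V) (p q : Formula Θ Φ X) :
      FormulaEq Θ Φ (.ex x (.inf p (.ex x q))) (.inf (.ex x p) (.ex x q))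
  | ex_comm {X : Place Θ} (x y : X.V) (p : Formula Θ Φ X) :
      FormulaEq Θ Φ (.ex x (.ex y p)) (.ex y (.ex x p))
  -- equalities
  | eq_refl {X : Place Θ} {i : Γ} (t : W X i) : FormulaEq Θ Φ (.eq t t) (.top X)
  | eq_op {X : Place Θ} (o : Θ.Op) (t t' : Tuple (W X) (Θ.dom o)) :
      FormulaEq Θ Φ
        (.inf (.conj (List.ofFn fun k => .eq (t k) (t' k))) (.eq ((W X).op o t) ((W X).op o t')))
        (.conj (List.ofFn fun k => .eq (t k) (t' k)))
  -- functoriality; the operations `s` are Boolean homomorphisms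
  | sub_id {X : Place Θ} (p : Formula Θ Φ X) : FormulaEq Θ Φ (.sub (Hom.id (W X)) p) p
  | sub_comp {X Y Z : Place Θ} (s : Hom (W X) (W Y)) (s' : Hom (W Y) (W Z))
      (p : Formula Θ Φ X) : FormulaEq Θ Φ (.sub (s'.comp s) p) (.sub s' (.sub s p))
  | sub_sup {X Y : Place Θ} (s : Hom (W X) (W Y)) (p q : Formula Θ Φ X) :
      FormulaEq Θ Φ (.sub s (.sup p q)) (.sup (.sub s p) (.sub s q))
  | sub_inf {X Y : Place Θ} (s : Hom (W X) (W Y)) (p q : Formula Θ Φ X) :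
      FormulaEq Θ Φ (.sub s (.inf p q)) (.inf (.sub s p) (.sub s q))
  | sub_compl {X Y : Place Θ} (s : Hom (W X) (W Y)) (p : Formula Θ Φ X) :
      FormulaEq Θ Φ (.sub s (.compl p)) (.compl (.sub s p))
  -- coordination with the quantifiers
  | sub_ex_congr {X Y : Place Θ} (s s' : Hom (W X) (W Y)) (x : X.V) (p : Formula Θ Φ X) :
      (∀ y, y ≠ x → s.toFun _ (gen X y) = s'.toFun _ (gen X y)) →
      FormulaEq Θ Φ (.sub s (.ex x p)) (.sub s' (.ex x p))
  | sub_ex {X Y : Place Θ} (s : Hom (W X) (W Y)) (x : X.V) (y : Y.V)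
      (h : Y.srt y = X.srt x) (p : Formula Θ Φ X) :
      s.toFun _ (gen X x) = h ▸ gen Y y →
      (∀ x', x' ≠ x → Avoids y (s.toFun _ (gen X x'))) →
      FormulaEq Θ Φ (.sub s (.ex x p)) (.ex y (.sub s p))
  -- coordination with the equalities
  | sub_eq {X Y : Place Θ} (s : Hom (W X) (W Y)) {i : Γ} (t t' : W X i) :
      FormulaEq Θ Φ (.sub s (.eq t t')) (.eq (s.toFun _ t) (s.toFun _ t'))
  | single_inf_eq {X : Place Θ} (x : X.V) (t t' : W X (X.srt x)) (p : Formula Θ Φ X) :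
      FormulaEq Θ Φ (.inf (.inf (.sub (single x t) p) (.eq t t')) (.sub (single x t') p))
        (.inf (.sub (single x t) p) (.eq t t'))
  -- the relations for the atomic formulas
  | sub_rel {X Y : Place Θ} (s : Hom (W X) (W Y)) (r : Φ.Rel) (t : Tuple (W X) (Φ.arity r)) :
      FormulaEq Θ Φ (.sub s (.rel r t)) (.rel r fun k => s.toFun _ (t k))

theorem mem_val_conj {Φ : RelSig.{u, b} Γ} {G : Alg.{u, v, a, w} Θ} (f : Realization Φ G)
    {X : Place Θ} (l : List (Formula Θ Φ X)) (μ : Point X G) :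
    μ ∈ (Formula.conj l).val f ↔ ∀ p ∈ l, μ ∈ p.val f := by
  induction l with
  | nil => simp [Formula.conj, Formula.val]
  | cons p l ih =>
    rw [List.forall_mem_cons, ← ih]
    rfl

theorem FormulaEq.sound {Φ : RelSig.{u, b} Γ} {G : Alg.{u, v, a, w} Θ} (f : Realization Φ G)
    {X : Place Θ} {p q : Formula Θ Φ X} (h : FormulaEq Θ Φ p q) : p.val f = q.val f := by
  induction h with
  | refl => rfl
  | symm _ ih => exact ih.symm
  | trans _ _ ih₁ ih₂ => exact ih₁.trans ih₂
  | sup _ _ ih₁ ih₂ => simp only [Formula.val, ih₁, ih₂]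
  | inf _ _ ih₁ ih₂ => simp only [Formula.val, ih₁, ih₂]
  | compl _ ih => simp only [Formula.val, ih]
  | ex _ _ ih => simp only [Formula.val, ih]
  | sub _ _ ih => simp only [Formula.val, ih]
  | sup_comm p q => exact Set.union_comm _ _
  | inf_comm p q => exact Set.inter_comm _ _
  | sup_assoc p q r => exact Set.union_assoc _ _ _
  | inf_assoc p q r => exact Set.inter_assoc _ _ _
  | sup_inf_self p q => exact Set.union_eq_left.2 Set.inter_subset_left
  | inf_sup_self p q => exact Set.inter_eq_left.2 Set.subset_union_left
  | inf_sup_distrib p q r => exact Set.inter_union_distrib_left _ _ _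
  | sup_compl p => exact Set.union_compl_self _
  | inf_compl p => exact Set.inter_compl_self _
  | ex_bot x =>
    refine Set.eq_empty_of_forall_notMem ?_
    rintro μ ⟨ν, hν, -⟩
    exact hν
  | le_ex x p => exact Set.inter_eq_left.2 fun μ hμ => ⟨μ, hμ, fun _ _ => rfl⟩
  | ex_inf_ex x p q =>
    refine Set.ext fun μ => ?_
    constructor
    · rintro ⟨ν, ⟨h₁, ρ, h₂, h₃⟩, h₄⟩
      exact ⟨⟨ν, h₁, h₄⟩, ρ, h₂, fun y hy => (h₄ y hy).trans (h₃ y hy)⟩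
    · rintro ⟨⟨ν, h₁, h₄⟩, ρ, h₂, h₃⟩
      exact ⟨ν, ⟨h₁, ρ, h₂, fun y hy => (h₄ y hy).symm.trans (h₃ y hy)⟩, h₄⟩
  | @ex_comm X x y p =>
    classical
    have key : ∀ (x y : X.V) (A : Set (Point X G)),
        exSet x (exSet y A) ⊆ exSet y (exSet x A) := by
      rintro x y A μ ⟨ν, ⟨ρ, h₁, h₂⟩, h₃⟩
      by_cases hxy : x = y
      · subst hxy
        exact ⟨ν, ⟨ρ, h₁, h₂⟩, h₃⟩
      refine ⟨lift (Function.update (fun z => μ.toFun _ (gen X z)) y (ρ.toFun _ (gen X y))),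
        ⟨ρ, h₁, fun z hz => ?_⟩, fun z hz => ?_⟩
      · rw [lift_gen]
        by_cases hzy : z = y
        · subst hzy; simp
        · rw [Function.update_of_ne hzy, h₃ z hz, h₂ z hzy]
      · rw [lift_gen, Function.update_of_ne hz]
    exact Set.Subset.antisymm (key x y _) (key y x _)
  | eq_refl t => exact Set.eq_univ_of_forall fun _ => rfl
  | eq_op o t t' =>
    refine Set.inter_eq_left.2 fun μ hμ => ?_
    have h := (mem_val_conj f _ μ).1 hμ
    change μ.toFun _ _ = μ.toFun _ _
    rw [μ.map_op, μ.map_op]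
    congr 1
    funext k
    exact h (.eq (t k) (t' k)) (List.mem_ofFn.2 ⟨k, rfl⟩)
  | sub_id p => rfl
  | sub_comp s s' p => rfl
  | sub_sup s p q => rfl
  | sub_inf s p q => rfl
  | sub_compl s p => rfl
  | sub_ex_congr s s' x p h =>
    refine Set.ext fun μ => ?_
    constructor
    · rintro ⟨ν, h₁, h₂⟩
      exact ⟨ν, h₁, fun y hy => (congrArg (μ.toFun _) (h y hy)).symm.trans (h₂ y hy)⟩
    · rintro ⟨ν, h₁, h₂⟩
      exact ⟨ν, h₁, fun y hy => (congrArg (μ.toFun _) (h y hy)).trans (h₂ y hy)⟩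
  | @sub_ex X Y s x y h p h₁ h₂ =>
    classical
    have hcast' : ∀ {i j : Γ} (e : i = j) (g : G j), (e ▸ (e.symm ▸ g : G i) : G j) = g := by
      rintro _ _ rfl _; rfl
    have hcast : ∀ (μ : Point Y G) {i : Γ} (e : Y.srt y = i),
        μ.toFun i (e ▸ gen Y y) = e ▸ μ.toFun _ (gen Y y) := by
      rintro μ _ rfl; rfl
    refine Set.ext fun μ => ?_
    constructor
    · rintro ⟨ν, h₃, h₄⟩
      let e : ∀ z : Y.V, G (Y.srt z) := Function.update (fun z => μ.toFun _ (gen Y z)) y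
        (h.symm ▸ ν.toFun _ (gen X x))
      have he : ∀ z, z ≠ y → μ.toFun _ (gen Y z) = (lift e).toFun _ (gen Y z) := by
        intro z hz
        rw [lift_gen]
        simp only [e]
        rw [Function.update_of_ne hz]
      refine ⟨lift e, ?_, he⟩
      have key : (lift e).comp s = ν := by
        refine hom_ext fun z => ?_
        change (lift e).toFun _ (s.toFun _ (gen X z)) = _
        by_cases hz : z = x
        · subst hz
          rw [h₁, hcast, lift_gen]
          simp only [e, Function.update_self]
          exact hcast' h _
        · rw [← h₄ z hz]
          exact (h₂ z hz).congr fun y' hy' => (he y' hy').symm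
      change (lift e).comp s ∈ p.val f
      rw [key]
      exact h₃
    · rintro ⟨ν, h₃, h₄⟩
      exact ⟨ν.comp s, h₃, fun z hz => (h₂ z hz).congr h₄⟩
  | sub_eq s t t' => rfl
  | @single_inf_eq X x t t' p =>
    classical
    refine Set.inter_eq_left.2 ?_
    rintro μ ⟨h₁, h₂⟩
    have : μ.comp (single x t') = μ.comp (single x t) := by
      refine hom_ext fun z => ?_
      change μ.toFun _ ((single x t').toFun _ _) = μ.toFun _ ((single x t).toFun _ _)
      rw [single, single, lift_gen, lift_gen]
      by_cases hz : z = x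
      · subst hz
        simpa using h₂.symm
      · rw [Function.update_of_ne hz, Function.update_of_ne hz]
    change μ.comp (single x t') ∈ p.val f
    rw [this]
    exact h₁
  | sub_rel s r t => rfl

/-- The set `Hal_{ΦΘ}(X)` of (squeezed) formulas of the type `X`. -/
def Hal (Θ : Variety.{u, v, a} Γ) (Φ : RelSig.{u, b} Γ) (X : Place Θ) :=
  Quot (FormulaEq Θ Φ (X := X))

/-- The value `Val_f(u)` of a formula in the model `(G, Φ, f)`. -/
def Val {Φ : RelSig.{u, b} Γ} {G : Alg.{u, v, a, w} Θ} (f : Realization Φ G) {X : Place Θ} :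
    Hal Θ Φ X → Set (Point X G) :=
  Quot.lift (fun p => p.val f) fun _ _ h => h.sound f

/-- The algebra `R_f`: the image of `Val_f`, as a subalgebra of `Hal_Θ(G)`. -/
def R {Φ : RelSig.{u, b} Γ} {G : Alg.{u, v, a, w} Θ} (f : Realization Φ G) : LAlg Θ where
  carrier X := Set.range (Val f (X := X))
  bot X := ⟨(HalG G).bot X, Quot.mk _ (.bot X), rfl⟩
  top X := ⟨(HalG G).top X, Quot.mk _ (.top X), rfl⟩
  sup A B := ⟨(HalG G).sup A.1 B.1, by
    obtain ⟨_, ⟨p⟩, rfl⟩ := A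
    obtain ⟨_, ⟨q⟩, rfl⟩ := B
    exact ⟨Quot.mk _ (.sup p q), rfl⟩⟩
  inf A B := ⟨(HalG G).inf A.1 B.1, by
    obtain ⟨_, ⟨p⟩, rfl⟩ := A
    obtain ⟨_, ⟨q⟩, rfl⟩ := B
    exact ⟨Quot.mk _ (.inf p q), rfl⟩⟩
  compl A := ⟨(HalG G).compl A.1, by
    obtain ⟨_, ⟨p⟩, rfl⟩ := A
    exact ⟨Quot.mk _ (.compl p), rfl⟩⟩
  ex x A := ⟨(HalG G).ex x A.1, by
    obtain ⟨_, ⟨p⟩, rfl⟩ := A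
    exact ⟨Quot.mk _ (.ex x p), rfl⟩⟩
  eq s t := ⟨(HalG G).eq s t, Quot.mk _ (.eq s t), rfl⟩
  sub s A := ⟨(HalG G).sub s A.1, by
    obtain ⟨_, ⟨p⟩, rfl⟩ := A
    exact ⟨Quot.mk _ (.sub s p), rfl⟩⟩

/-! ### The weak category of algebraic sets of a model -/

/-- The set `T^f` of the points that satisfy all formulas in `T`. -/
def locus {Φ : RelSig.{u, b} Γ} {G : Alg.{u, v, a, w} Θ} (f : Realization Φ G) {X : Place Θ}
    (T : Set (Hal Θ Φ X)) : Set (Point X G) :=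
  ⋂ p ∈ T, Val f p

/-- The algebraic sets of the model in `Hom(W(X), G)`. -/
abbrev AlgSet {Φ : RelSig.{u, b} Γ} {G : Alg.{u, v, a, w} Θ} (f : Realization Φ G)
    (X : Place Θ) :=
  {A : Set (Point X G) // ∃ T : Set (Hal Θ Φ X), A = locus f T}

/-- The value of a formula, as an algebraic set. -/
def AlgSet.ofFormula {Φ : RelSig.{u, b} Γ} {G : Alg.{u, v, a, w} Θ} (f : Realization Φ G)
    {X : Place Θ} (p : Hal Θ Φ X) : AlgSet f X :=
  ⟨Val f p, {p}, by simp [locus]⟩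

/-- The objects `(X, A)` of the category `K_{ΦΘ}(f)`. -/
structure K {Φ : RelSig.{u, b} Γ} {G : Alg.{u, v, a, w} Θ} (f : Realization Φ G) where
  place : Place Θ
  set : AlgSet f place

/-- The weak category `K_{ΦΘ}(f)`: the morphisms `(X, A) → (Y, B)` are the homomorphisms
`s : W(Y) → W(X)` with `ν s ∈ B` for all `ν ∈ A`. -/
noncomputable instance {Φ : RelSig.{u, b} Γ} {G : Alg.{u, v, a, w} Θ} (f : Realization Φ G) :
    Category (K f) where
  Hom P Q := {s : Hom (W Q.place) (W P.place) // ∀ ν ∈ P.set.1, ν.comp s ∈ Q.set.1}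
  id P := ⟨Hom.id _, fun _ h => h⟩
  comp s t := ⟨s.1.comp t.1, fun ν h => t.2 _ (s.2 ν h)⟩

/-- An isomorphism `γ` of the weak categories `K_{Φ₁Θ}(f₁)` and `K_{Φ₂Θ}(f₂)` (with inverse
`inv`) that preserves the type `X` of an algebraic set, so that it acts on the objects by
mappings `onSet X` of algebraic sets, is coordinated with inclusions, and induces an
isomorphism of the algebras `R_{f₁}` and `R_{f₂}`. -/
structure KIso {Φ₁ : RelSig.{u, b₁} Γ} {Φ₂ : RelSig.{u, b₂} Γ} {G₁ : Alg.{u, v, a, w₁} Θ}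
    {G₂ : Alg.{u, v, a, w₂} Θ} (f₁ : Realization Φ₁ G₁) (f₂ : Realization Φ₂ G₂) where
  functor : K f₁ ⥤ K f₂
  inv : K f₂ ⥤ K f₁
  functor_inv : functor ⋙ inv = 𝟭 (K f₁)
  inv_functor : inv ⋙ functor = 𝟭 (K f₂)
  onSet : ∀ X : Place Θ, AlgSet f₁ X → AlgSet f₂ X
  obj_eq : ∀ (X : Place Θ) (A : AlgSet f₁ X), functor.obj ⟨X, A⟩ = ⟨X, onSet X A⟩
  subset_iff : ∀ (X : Place Θ) (A B : AlgSet f₁ X),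
    (onSet X A).1 ⊆ (onSet X B).1 ↔ A.1 ⊆ B.1
  onR : (R f₁).Iso (R f₂)
  onSet_eq_onR : ∀ (X : Place Θ) (p : Hal Θ Φ₁ X),
    (onSet X (AlgSet.ofFormula f₁ p)).1 = (onR.toEquiv X ⟨Val f₁ p, p, rfl⟩).1

/-- For one and the same `Φ`: the isomorphism is correct if `γ Val_{f₁} = Val_{f₂}`. -/
def KIso.Correct {Φ : RelSig.{u, b} Γ} {G₁ : Alg.{u, v, a, w₁} Θ} {G₂ : Alg.{u, v, a, w₂} Θ}
    {f₁ : Realization Φ G₁} {f₂ : Realization Φ G₂} (γ : KIso f₁ f₂) : Prop :=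
  ∀ (X : Place Θ) (p : Hal Θ Φ X),
    γ.onSet X (AlgSet.ofFormula f₁ p) = AlgSet.ofFormula f₂ p

/-! ### Multimodels and knowledge bases -/

/-- A multimodel `(G, Φ, F)`: an algebra with a set of realizations (instances). -/
structure Multimodel (Θ : Variety.{u, v, a} Γ) (Φ : RelSig.{u, b} Γ) where
  G : Alg.{u, v, a, w} Θ
  F : Set (Realization Φ G)

/-- The knowledge base `KB(G, Φ, F)`. Its objects are the mappings `Val_f : Hal_{ΦΘ} → K_{ΦΘ}(f)`,
one for every instance `f ∈ F`. -/
structure KB {Φ : RelSig.{u, b} Γ} (M : Multimodel.{u, v, a, b, w} Θ Φ) where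
  inst : M.F

/-- Morphisms of a knowledge base: functors `γ : K_{ΦΘ}(f₁) → K_{ΦΘ}(f₂)` with
`γ (T^{f₁}) = T^{f₂}` for all sets of formulas `T`; for `T = {u}` this is `γ Val_{f₁} = Val_{f₂}`. -/
@[ext]
structure KB.Mor {Φ : RelSig.{u, b} Γ} {M : Multimodel.{u, v, a, b, w} Θ Φ} (P Q : KB M) where
  functor : K P.inst.1 ⥤ K Q.inst.1
  map_locus : ∀ (X : Place Θ) (T : Set (Hal Θ Φ X)),
    functor.obj ⟨X, locus P.inst.1 T, T, rfl⟩ = ⟨X, locus Q.inst.1 T, T, rfl⟩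

/-- The knowledge base as a category. -/
noncomputable instance {Φ : RelSig.{u, b} Γ} (M : Multimodel.{u, v, a, b, w} Θ Φ) :
    Category (KB M) where
  Hom := KB.Mor
  id P := ⟨𝟭 _, fun _ _ => rfl⟩
  comp g h := ⟨g.functor ⋙ h.functor, fun X T => by
    rw [Functor.comp_obj, g.map_locus, h.map_locus]⟩

/-- Equivalence of the knowledge bases of two multimodels: a bijection `α` of the instances
together with isomorphisms `γ_f` of the weak categories of algebraic sets. -/
def KBEquivalent {Φ₁ : RelSig.{u, b₁} Γ} {Φ₂ : RelSig.{u, b₂} Γ}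
    (M₁ : Multimodel.{u, v, a, b₁, w₁} Θ Φ₁) (M₂ : Multimodel.{u, v, a, b₂, w₂} Θ Φ₂) : Prop :=
  ∃ α : M₁.F ≃ M₂.F, ∀ f : M₁.F, Nonempty (KIso f.1 (α f).1)

/-- Isomorphism of the knowledge bases of two multimodels with the same `Φ`: an isomorphism `E`
of the categories (with inverse `E'`) that is given by correct isomorphisms `γ_f`, where `E`
transforms a morphism `g` from `f₁` to `f₂` into `γ_{f₂} g γ_{f₁}⁻¹`. -/
def KBIsomorphic {Φ : RelSig.{u, b} Γ}
    (M₁ : Multimodel.{u, v, a, b, w₁} Θ Φ) (M₂ : Multimodel.{u, v, a, b, w₂} Θ Φ) : Prop :=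
  ∃ (E : KB M₁ ⥤ KB M₂) (E' : KB M₂ ⥤ KB M₁)
    (γ : ∀ P : KB M₁, KIso P.inst.1 (E.obj P).inst.1),
    E ⋙ E' = 𝟭 (KB M₁) ∧ E' ⋙ E = 𝟭 (KB M₂) ∧
    (∀ P, (γ P).Correct) ∧
    ∀ (P Q : KB M₁) (g : P ⟶ Q),
      KB.Mor.functor (E.map g) = (γ P).inv ⋙ KB.Mor.functor g ⋙ (γ Q).functor

/-- The isomorphism of algebras `δ` is an isomorphism of models. -/
def IsModelIso {Φ : RelSig.{u, b} Γ} {G₁ : Alg.{u, v, a, w₁} Θ} {G₂ : Alg.{u, v, a, w₂} Θ}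
    (f₁ : Realization Φ G₁) (f₂ : Realization Φ G₂) (δ : Iso G₁ G₂) : Prop :=
  ∀ (r : Φ.Rel) (t : Tuple G₁ (Φ.arity r)), t ∈ f₁ r ↔ (fun k => δ.toEquiv _ (t k)) ∈ f₂ r

/-- The group `Aut(f)` of automorphisms of the model `(G, Φ, f)`, as a set of automorphisms
of `G`. -/
def modelAut {Φ : RelSig.{u, b} Γ} {G : Alg.{u, v, a, w} Θ} (f : Realization Φ G) :
    Set (Iso G G) :=
  {σ | IsModelIso f f σ}

/-- Automorphic equivalence of models: `Aut(f₂) = δ⁻¹ Aut(f₁) δ` for some isomorphism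
of algebras `δ : G₂ → G₁`. -/
def ModelAutEquivalent {Φ₁ : RelSig.{u, b₁} Γ} {Φ₂ : RelSig.{u, b₂} Γ}
    {G₁ : Alg.{u, v, a, w₁} Θ} {G₂ : Alg.{u, v, a, w₂} Θ}
    (f₁ : Realization Φ₁ G₁) (f₂ : Realization Φ₂ G₂) : Prop :=
  ∃ δ : Iso G₂ G₁, modelAut f₂ = (fun σ => (δ.trans σ).trans δ.symm) '' modelAut f₁

/-- Automorphic equivalence of multimodels. -/
def AutEquivalent {Φ₁ : RelSig.{u, b₁} Γ} {Φ₂ : RelSig.{u, b₂} Γ}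
    (M₁ : Multimodel.{u, v, a, b₁, w₁} Θ Φ₁) (M₂ : Multimodel.{u, v, a, b₂, w₂} Θ Φ₂) : Prop :=
  ∃ α : M₁.F ≃ M₂.F, ∀ f : M₁.F, ModelAutEquivalent f.1 (α f).1

/-- Isomorphism of multimodels. -/
def Multimodel.Isomorphic {Φ : RelSig.{u, b} Γ}
    (M₁ : Multimodel.{u, v, a, b, w₁} Θ Φ) (M₂ : Multimodel.{u, v, a, b, w₂} Θ Φ) : Prop :=
  ∃ α : M₁.F ≃ M₂.F, ∀ f : M₁.F, ∃ δ : Iso M₁.G M₂.G, IsModelIso f.1 (α f).1 δ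

end KnowledgeBase

namespace KnowledgeBase

variable {Γ : Type u} {Θ : Variety.{u, v, a} Γ}

/-! ### Isomorphisms -/

/-! Everything rests on surjective points. As the sorts and carriers are finite and variables are
infinite in every sort, some place `X` has a point `μ : W(X) → G` onto `G`. Such a point names every
element of `G`, so the formulas true at `μ` determine the model, and every other point has the form
`μ s` for some substitution `s`.

Consequently the definable sets of a finite model are exactly the sets of points invariant under
`Aut(f)` (`definable_iff_invariant`): two points lying in the same definable sets extend to
surjective points with equal kernels, and these differ by an automorphism of the model. Finiteness
also makes algebraic sets and definable sets the same (`definable_iff_algebraic`).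

If `δ` conjugates the automorphism groups, it matches invariant sets, hence definable sets, and
pulling back along `δ` is an isomorphism of the weak categories (`KIso.ofIso`). Conversely, an
isomorphism `R f₁ ≅ R f₂` sends the smallest definable set around a surjective `μ` to a non-empty
set. A point `ν` of that set satisfies the same equalities as `μ`, which embeds `G₁` into `G₂`; by
symmetry and counting the embedding is an isomorphism `δ`. Since `σ μ = μ s` turns an automorphism
into a substitution, the automorphism groups are visible in `R f₁` and `R f₂` and correspond under
`δ` (`modelAutEquivalent_of_iso`).

For a common `Φ`, correctness says that `μ` and `δ μ` satisfy the same formulas, so `δ` is an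
isomorphism of models. In the other direction an isomorphism of models gives correct `γ_f`, and
conjugation by them is the isomorphism of knowledge bases (`kbIsomorphic_of_kIso`). -/

theorem Iso.ext' {G : Alg.{u, v, a, w} Θ} {H : Alg.{u, v, a, w₁} Θ} {δ ε : Iso G H}
    (h : ∀ i g, δ.toEquiv i g = ε.toEquiv i g) : δ = ε := by
  cases δ; cases ε
  congr
  funext i
  exact Equiv.ext (h i)

/-- The homomorphism underlying an isomorphism. -/
def Iso.toHom {G : Alg.{u, v, a, w} Θ} {H : Alg.{u, v, a, w₁} Θ} (δ : Iso G H) : Hom G H where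
  toFun i := δ.toEquiv i
  map_op := δ.map_op

@[simp]
theorem Iso.comp_symm_comp {G : Alg.{u, v, a, w} Θ} {H : Alg.{u, v, a, w₁} Θ}
    {K : Alg.{u, v, a, w₂} Θ} (δ : Iso G H) (μ : Hom K H) :
    δ.toHom.comp (δ.symm.toHom.comp μ) = μ := by
  ext i k
  exact (δ.toEquiv i).apply_symm_apply _

/-- A bijective homomorphism is an isomorphism. -/
noncomputable def Iso.ofBijective {G : Alg.{u, v, a, w} Θ} {H : Alg.{u, v, a, w₁} Θ}
    (j : Hom G H) (hj : ∀ i, Function.Bijective (j.toFun i)) : Iso G H where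
  toEquiv i := Equiv.ofBijective _ (hj i)
  map_op := j.map_op

/-- A homomorphism factors through a surjective one with the same kernel. -/
theorem exists_injective_hom_of_ker_eq {G : Alg.{u, v, a, w} Θ} {H : Alg.{u, v, a, w₁} Θ}
    {K : Alg.{u, v, a, w₂} Θ} (μ : Hom K G) (ν : Hom K H)
    (hμ : ∀ i, Function.Surjective (μ.toFun i))
    (h : ∀ i (p q : K i), μ.toFun i p = μ.toFun i q ↔ ν.toFun i p = ν.toFun i q) :
    ∃ j : Hom G H, (∀ i, Function.Injective (j.toFun i)) ∧ j.comp μ = ν := by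
  choose r hr using hμ
  have key : ∀ i p, ν.toFun i (r i (μ.toFun i p)) = ν.toFun i p := fun i p =>
    (h i _ _).1 (hr i _)
  refine ⟨⟨fun i g => ν.toFun i (r i g), fun o t => ?_⟩, fun i g g' hg => ?_, ?_⟩
  · rw [← ν.map_op, ← h, hr, μ.map_op]
    simp only [hr]
  · rw [← hr i g, ← hr i g']
    exact (h i _ _).2 hg
  · ext i p
    exact key i p

/-- By freeness of `W(Y)` it suffices to lift the values of `ν` on the generators through `μ`. This
is how an automorphism is later replaced by a substitution. -/
theorem exists_comp_eq {X Y : Place Θ} {G : Alg.{u, v, a, w} Θ} (μ : Point X G)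
    (hμ : ∀ i, Function.Surjective (μ.toFun i)) (ν : Point Y G) :
    ∃ s : Hom (W Y) (W X), μ.comp s = ν := by
  choose r hr using hμ
  exact ⟨lift fun y => r _ (ν.toFun _ (gen Y y)), hom_ext fun y => hr _ _⟩

/-! ### Model isomorphisms and values of formulas -/

theorem IsModelIso.mem_val_iff {Φ : RelSig.{u, b} Γ} {G₁ : Alg.{u, v, a, w₁} Θ}
    {G₂ : Alg.{u, v, a, w₂} Θ} {f₁ : Realization Φ G₁} {f₂ : Realization Φ G₂} {δ : Iso G₁ G₂}
    (hδ : IsModelIso f₁ f₂ δ) {X : Place Θ} (p : Formula Θ Φ X) (μ : Point X G₁) :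
    μ ∈ p.val f₁ ↔ δ.toHom.comp μ ∈ p.val f₂ := by
  induction p with
  | rel r t => exact hδ r _
  | bot => exact Iff.rfl
  | top => exact Iff.rfl
  | sup p q hp hq => exact or_congr (hp μ) (hq μ)
  | inf p q hp hq => exact and_congr (hp μ) (hq μ)
  | compl p hp => exact not_congr (hp μ)
  | ex x p hp =>
    constructor
    · rintro ⟨ν, hν, h⟩
      exact ⟨_, (hp ν).1 hν, fun y hy => congrArg (δ.toEquiv _) (h y hy)⟩
    · rintro ⟨ν, hν, h⟩
      refine ⟨δ.symm.toHom.comp ν, (hp _).2 (by simpa using hν), fun y hy => ?_⟩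
      exact (Equiv.eq_symm_apply _).2 (h y hy)
  | eq p q => exact (δ.toEquiv _).injective.eq_iff.symm
  | sub s p hp => exact hp _

/-- A surjective `μ` writes every tuple of `G₁` as the value of a tuple of terms, so atomic formulas
at this single point already test all the relations. -/
theorem IsModelIso.of_mem_val_iff {Φ : RelSig.{u, b} Γ} {G₁ : Alg.{u, v, a, w₁} Θ}
    {G₂ : Alg.{u, v, a, w₂} Θ} {f₁ : Realization Φ G₁} {f₂ : Realization Φ G₂} {δ : Iso G₁ G₂}
    {X : Place Θ} (μ : Point X G₁) (hμ : ∀ i, Function.Surjective (μ.toFun i))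
    (h : ∀ p : Formula Θ Φ X, μ ∈ p.val f₁ ↔ δ.toHom.comp μ ∈ p.val f₂) :
    IsModelIso f₁ f₂ δ := by
  intro r t
  choose c hc using hμ
  have := h (.rel r fun k => c _ (t k))
  simp only [Formula.val, Set.mem_ofPred_eq, hc] at this
  rw [this]
  simp only [Hom.comp, hc]
  rfl

/-! ### Definable sets -/

/-- The sets of points that are values of formulas. -/
def Definable {Φ : RelSig.{u, b} Γ} {G : Alg.{u, v, a, w} Θ} (f : Realization Φ G) {X : Place Θ}
    (A : Set (Point X G)) : Prop :=
  ∃ p : Formula Θ Φ X, p.val f = A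

section Definable

variable {Φ : RelSig.{u, b} Γ} {G : Alg.{u, v, a, w} Θ} {f : Realization Φ G} {X : Place Θ}

theorem definable_iff_mem_range {A : Set (Point X G)} :
    Definable f A ↔ A ∈ Set.range (Val f (X := X)) := by
  constructor
  · rintro ⟨p, rfl⟩
    exact ⟨Quot.mk _ p, rfl⟩
  · rintro ⟨⟨p⟩, rfl⟩
    exact ⟨p, rfl⟩

theorem definable_val (p : Hal Θ Φ X) : Definable f (Val f p) :=
  definable_iff_mem_range.2 ⟨p, rfl⟩

theorem Definable.compl {A : Set (Point X G)} (h : Definable f A) : Definable f Aᶜ := by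
  obtain ⟨p, rfl⟩ := h
  exact ⟨.compl p, rfl⟩

theorem Definable.ex {A : Set (Point X G)} (x : X.V) (h : Definable f A) :
    Definable f (exSet x A) := by
  obtain ⟨p, rfl⟩ := h
  exact ⟨.ex x p, rfl⟩

theorem Definable.sub {Y : Place Θ} {A : Set (Point X G)} (s : Hom (W X) (W Y))
    (h : Definable f A) : Definable f (subSet s A) := by
  obtain ⟨p, rfl⟩ := h
  exact ⟨.sub s p, rfl⟩

theorem Definable.sInter {𝒜 : Set (Set (Point X G))} (hfin : 𝒜.Finite)
    (h : ∀ A ∈ 𝒜, Definable f A) : Definable f (⋂₀ 𝒜) := by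
  induction 𝒜, hfin using Set.Finite.induction_on with
  | empty => exact ⟨.top X, by rw [Set.sInter_empty]; rfl⟩
  | @insert A 𝒜 _ _ ih =>
    obtain ⟨p, hp⟩ := h A (Set.mem_insert _ _)
    obtain ⟨q, hq⟩ := ih fun B hB => h B (Set.mem_insert_of_mem _ hB)
    exact ⟨.inf p q, by rw [Set.sInter_insert, ← hp, ← hq]; rfl⟩

theorem Definable.sUnion {𝒜 : Set (Set (Point X G))} (hfin : 𝒜.Finite)
    (h : ∀ A ∈ 𝒜, Definable f A) : Definable f (⋃₀ 𝒜) := by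
  rw [Set.sUnion_eq_compl_sInter_compl]
  refine (Definable.sInter (hfin.image _) ?_).compl
  rintro _ ⟨A, hA, rfl⟩
  exact (h A hA).compl

theorem finite_point (hG : ∀ i, Finite (G i)) (X : Place Θ) : Finite (Point X G) :=
  Finite.of_injective (β := ∀ x : X.V, G (X.srt x)) (fun μ x => μ.toFun _ (gen X x))
    fun _ _ h => hom_ext fun x => congrFun h x

/-- However large `T` is, its formulas have only finitely many distinct values, so a finite
conjunction defines the locus. -/
theorem definable_iff_algebraic (hG : ∀ i, Finite (G i)) {A : Set (Point X G)} :
    Definable f A ↔ ∃ T : Set (Hal Θ Φ X), A = locus f T := by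
  have := finite_point hG X
  constructor
  · intro h
    obtain ⟨p, rfl⟩ := definable_iff_mem_range.1 h
    exact ⟨{p}, by simp [locus]⟩
  · rintro ⟨T, rfl⟩
    have : locus f T = ⋂₀ (Val f '' T) := by simp [locus]
    rw [this]
    refine Definable.sInter (Set.toFinite _) ?_
    rintro _ ⟨p, -, rfl⟩
    exact definable_val p

/-- The intersection of all definable sets that contain the point `μ`. -/
def atomOf (f : Realization Φ G) (μ : Point X G) : Set (Point X G) :=
  ⋂₀ {A | Definable f A ∧ μ ∈ A}

theorem mem_atomOf_self (μ : Point X G) : μ ∈ atomOf f μ := fun _ h => h.2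

theorem definable_atomOf (hG : ∀ i, Finite (G i)) (μ : Point X G) :
    Definable f (atomOf f μ) := by
  have := finite_point hG X
  exact Definable.sInter (Set.toFinite _) fun A h => h.1

/-- Closure under complements makes the relation symmetric: the sets `atomOf f μ` are the atoms of
the Boolean algebra of definable sets. -/
theorem mem_iff_of_mem_atomOf {μ ν : Point X G} (h : ν ∈ atomOf f μ) {A : Set (Point X G)}
    (hA : Definable f A) : μ ∈ A ↔ ν ∈ A := by
  refine ⟨fun hμ => h A ⟨hA, hμ⟩, fun hν => ?_⟩
  by_contra hμ
  exact h Aᶜ ⟨hA.compl, hμ⟩ hν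

/-- This is quantification over all variables in `l`, one `exSet` for each entry. -/
theorem Definable.exists_agree {A : Set (Point X G)} (h : Definable f A) (l : List X.V) :
    Definable f {μ | ∃ ν ∈ A, ∀ y ∉ l, μ.toFun _ (gen X y) = ν.toFun _ (gen X y)} := by
  classical
  induction l with
  | nil =>
    convert h using 1
    refine Set.ext fun μ => ⟨?_, fun hμ => ⟨μ, hμ, fun _ _ => rfl⟩⟩
    rintro ⟨ν, hν, hμν⟩
    rwa [hom_ext fun x => hμν x List.not_mem_nil]
  | cons x l ih =>
    convert ih.ex x using 1
    refine Set.ext fun μ => ⟨?_, ?_⟩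
    · rintro ⟨ν, hν, hμν⟩
      -- The intermediate point differs from `μ` only at `x`, where it already takes the value of
      -- `ν`.
      refine ⟨lift (Function.update (fun z => μ.toFun _ (gen X z)) x (ν.toFun _ (gen X x))),
        ⟨ν, hν, fun y hy => ?_⟩, fun y hy => ?_⟩
      · rw [lift_gen]
        by_cases hyx : y = x
        · subst hyx; simp
        · rw [Function.update_of_ne hyx]
          exact hμν y (by simp [hyx, hy])
      · rw [lift_gen, Function.update_of_ne hy]
    · rintro ⟨ρ, ⟨ν, hν, h₁⟩, h₂⟩
      refine ⟨ν, hν, fun y hy => ?_⟩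
      rw [List.mem_cons, not_or] at hy
      exact (h₂ y hy.1).trans (h₁ y hy.2)

end Definable

/-! ### Surjective points -/

/-- The total carrier `Σ i, G i` is finite. For each of its elements a fresh variable of the right
sort is adjoined and sent to it, leaving the earlier values unchanged. -/
theorem exists_finset_surjective_assignment [Finite Γ] {G : Alg.{u, v, a, w} Θ}
    (hG : ∀ i, Finite (G i)) (X : Finset Θ.Var) (e : ∀ x : Θ.Var, G (Θ.srt x)) :
    ∃ (Y : Finset Θ.Var) (e' : ∀ x : Θ.Var, G (Θ.srt x)), X ⊆ Y ∧ (∀ x ∈ X, e' x = e x) ∧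
      ∀ q : Σ i, G i, ∃ y ∈ Y, (⟨Θ.srt y, e' y⟩ : Σ i, G i) = q := by
  classical
  have key : ∀ 𝒮 : Finset (Σ i, G i), ∃ (Y : Finset Θ.Var) (e' : ∀ x : Θ.Var, G (Θ.srt x)),
      X ⊆ Y ∧ (∀ x ∈ X, e' x = e x) ∧
      ∀ q ∈ 𝒮, ∃ y ∈ Y, (⟨Θ.srt y, e' y⟩ : Σ i, G i) = q := by
    intro 𝒮
    induction 𝒮 using Finset.induction_on with
    | empty => exact ⟨X, e, subset_rfl, fun _ _ => rfl, by simp⟩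
    | insert q 𝒮 _ ih =>
      obtain ⟨Y, e', hXY, he, h⟩ := ih
      obtain ⟨i, g⟩ := q
      obtain ⟨y, hy, hyY⟩ := (Θ.infinite_var i).exists_notMem_finset Y
      obtain rfl : Θ.srt y = i := hy
      have hne : ∀ z ∈ Y, Function.update e' y g z = e' z := fun z hz =>
        Function.update_of_ne (ne_of_mem_of_not_mem hz hyY) _ _
      refine ⟨insert y Y, Function.update e' y g, hXY.trans (Finset.subset_insert _ _),
        fun x hx => (hne x (hXY hx)).trans (he x hx), fun q hq => ?_⟩
      rcases Finset.mem_insert.1 hq with rfl | hq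
      · exact ⟨y, Finset.mem_insert_self _ _, by simp⟩
      · obtain ⟨z, hz, hzq⟩ := h q hq
        exact ⟨z, Finset.mem_insert_of_mem hz, by rw [hne z hz, hzq]⟩
  have := Fintype.ofFinite (Σ i, G i)
  simpa using key Finset.univ

theorem exists_surjective_point [Finite Γ] {G : Alg.{u, v, a, w} Θ} (hG : ∀ i, Finite (G i))
    (X : Finset Θ.Var) (e : ∀ x : Θ.Var, G (Θ.srt x)) :
    ∃ (Y : Place Θ) (μ : Point Y G) (h : X ⊆ Y.vars), (∀ i, Function.Surjective (μ.toFun i)) ∧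
      ∀ (x : Θ.Var) (hx : x ∈ X), μ.toFun _ (gen Y ⟨x, h hx⟩) = e x := by
  obtain ⟨Y, e', hXY, he, h⟩ := exists_finset_surjective_assignment hG X e
  -- Carriers of `G` are non-empty, so `Y` contains a variable of every sort and is therefore a
  -- place.
  have hY : ∀ i, Nonempty (Term Θ.toSignature (fun x : {x // x ∈ Y} => Θ.srt x.1) i) := by
    intro i
    obtain ⟨g⟩ := G.nonempty i
    obtain ⟨y, hy, hyg⟩ := h ⟨i, g⟩
    obtain rfl : Θ.srt y = i := congrArg Sigma.fst hyg
    exact ⟨Term.var (srt := fun x : {x // x ∈ Y} => Θ.srt x.1) ⟨y, hy⟩⟩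
  refine ⟨⟨Y, hY⟩, lift fun y => e' y.1, hXY, fun i g => ?_, fun x hx => he x hx⟩
  obtain ⟨y, hy, hyg⟩ := h ⟨i, g⟩
  cases hyg
  exact ⟨gen ⟨Y, hY⟩ ⟨y, hy⟩, rfl⟩

/-! ### Definable sets of finite models are the invariant sets -/

/-- In a finite model, points in the same definable sets are conjugate. -/
theorem exists_modelAut_of_mem_atomOf [Finite Γ] {Φ : RelSig.{u, b} Γ} {G : Alg.{u, v, a, w} Θ}
    (hG : ∀ i, Finite (G i)) (f : Realization Φ G) {X : Place Θ} {μ μ' : Point X G}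
    (h : μ' ∈ atomOf f μ) : ∃ σ ∈ modelAut f, σ.toHom.comp μ = μ' := by
  classical
  -- `ν` is a surjective extension of `μ`; the default value outside `X` is irrelevant.
  obtain ⟨Y, ν, hXY, hν, hνμ⟩ := exists_surjective_point hG X.vars fun x =>
    if hx : x ∈ X.vars then μ.toFun _ (gen X ⟨x, hx⟩) else (G.nonempty _).some
  -- `s` fixes the variables of `X` and sends the others to arbitrary elements, harmless because
  -- those variables are quantified away.
  let s : Hom (W Y) (W X) := lift fun y =>
    if hy : y.1 ∈ X.vars then gen X ⟨y.1, hy⟩ else ((W X).nonempty _).some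
  let l : List Y.V := (Finset.univ.filter fun y : Y.V => y.1 ∉ X.vars).toList
  have hl : ∀ y, y ∉ l ↔ y.1 ∈ X.vars := by simp [l]
  have hs : ∀ x : X.V, s.toFun _ (gen Y ⟨x.1, hXY x.2⟩) = gen X x := by
    intro x
    simp only [s]
    rw [lift_gen, dif_pos x.2]
  -- The property of extending to a point of `atomOf f ν` is definable over `X`. It holds for `μ`,
  -- witnessed by `ν`, hence for `μ'`, which yields `ν'`.
  have hμ := (definable_atomOf (f := f) hG ν).exists_agree l |>.sub s
  obtain ⟨ν', hν', hagree⟩ := (mem_iff_of_mem_atomOf h hμ).1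
    ⟨ν, mem_atomOf_self ν, fun y hy => by
      have hyX := (hl y).1 hy
      have h₁ := hνμ y.1 hyX
      rw [dif_pos hyX] at h₁
      refine Eq.trans ?_ h₁.symm
      exact congrArg (μ.toFun _) (hs ⟨y.1, hyX⟩)⟩
  have hker : ∀ i (p q : W Y i), ν.toFun i p = ν.toFun i q ↔ ν'.toFun i p = ν'.toFun i q :=
    fun i p q => mem_iff_of_mem_atomOf hν' ⟨.eq p q, rfl⟩
  obtain ⟨j, hj, hjν⟩ := exists_injective_hom_of_ker_eq ν ν' hν hker
  -- An injective endomorphism of a finite algebra is bijective.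
  let σ : Iso G G := Iso.ofBijective j fun i => Finite.injective_iff_bijective.1 (hj i)
  have hσν : σ.toHom.comp ν = ν' := hjν
  refine ⟨σ, IsModelIso.of_mem_val_iff ν hν fun p => ?_, hom_ext fun x => ?_⟩
  · rw [hσν]
    exact mem_iff_of_mem_atomOf hν' ⟨p, rfl⟩
  · have h₁ := hνμ x.1 x.2
    rw [dif_pos x.2] at h₁
    have h₂ := hagree ⟨x.1, hXY x.2⟩ ((hl _).2 x.2)
    rw [← hσν] at h₂
    refine Eq.trans ?_ (h₂.symm.trans (congrArg (μ'.toFun _) (hs x)))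
    exact congrArg (σ.toEquiv _) h₁.symm

/-- Points of one atom are conjugate under `Aut(f)`, so an invariant set is the union of the atoms
of its points, and there are finitely many of these. -/
theorem definable_iff_invariant [Finite Γ] {Φ : RelSig.{u, b} Γ} {G : Alg.{u, v, a, w} Θ}
    (hG : ∀ i, Finite (G i)) (f : Realization Φ G) {X : Place Θ} {A : Set (Point X G)} :
    Definable f A ↔ ∀ σ ∈ modelAut f, ∀ μ ∈ A, σ.toHom.comp μ ∈ A := by
  have := finite_point hG X
  constructor
  · rintro ⟨p, rfl⟩ σ hσ μ hμ
    exact (IsModelIso.mem_val_iff hσ p μ).1 hμ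
  · intro h
    have hA : A = ⋃₀ (atomOf f '' A) := by
      refine Set.Subset.antisymm (fun μ hμ => ⟨_, ⟨μ, hμ, rfl⟩, mem_atomOf_self μ⟩) ?_
      rintro μ' ⟨_, ⟨μ, hμ, rfl⟩, hμ'⟩
      obtain ⟨σ, hσ, rfl⟩ := exists_modelAut_of_mem_atomOf hG f hμ'
      exact h σ hσ μ hμ
    rw [hA]
    refine Definable.sUnion (Set.toFinite _) ?_
    rintro _ ⟨μ, -, rfl⟩
    exact definable_atomOf hG μ

/-! ### From isomorphisms of the algebras of definable sets to isomorphisms of algebras -/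

/-- The inverse isomorphism. -/
def LAlg.Iso.symm {R : LAlg.{u, v, a, w₁} Θ} {R' : LAlg.{u, v, a, w₂} Θ} (φ : R.Iso R') :
    R'.Iso R where
  toEquiv X := (φ.toEquiv X).symm
  map_bot X := by rw [Equiv.symm_apply_eq, φ.map_bot]
  map_top X := by rw [Equiv.symm_apply_eq, φ.map_top]
  map_sup A B := by rw [Equiv.symm_apply_eq, φ.map_sup]; simp
  map_inf A B := by rw [Equiv.symm_apply_eq, φ.map_inf]; simp
  map_compl A := by rw [Equiv.symm_apply_eq, φ.map_compl]; simp
  map_ex x A := by rw [Equiv.symm_apply_eq, φ.map_ex]; simp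
  map_eq p q := by rw [Equiv.symm_apply_eq, φ.map_eq]
  map_sub s A := by rw [Equiv.symm_apply_eq, φ.map_sub]; simp

section

variable {Φ₁ : RelSig.{u, b₁} Γ} {Φ₂ : RelSig.{u, b₂} Γ} {G₁ : Alg.{u, v, a, w₁} Θ}
  {G₂ : Alg.{u, v, a, w₂} Θ} {f₁ : Realization Φ₁ G₁} {f₂ : Realization Φ₂ G₂}

/-- Any point in the image of `atomOf f₁ μ` will do. The image is non-empty because `φ` is injective
and preserves the empty set; complements give the converse implication. -/
theorem exists_corresponding_point (hG₁ : ∀ i, Finite (G₁ i)) (φ : (R f₁).Iso (R f₂))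
    {X : Place Θ} (μ : Point X G₁) :
    ∃ ν : Point X G₂, ∀ D : (R f₁).carrier X, μ ∈ D.1 ↔ ν ∈ (φ.toEquiv X D).1 := by
  let A : (R f₁).carrier X := ⟨atomOf f₁ μ, definable_iff_mem_range.1 (definable_atomOf hG₁ μ)⟩
  have hne : (φ.toEquiv X A).1.Nonempty := by
    by_contra hemp
    have h₁ : φ.toEquiv X A = (R f₂).bot X := Subtype.ext (Set.not_nonempty_iff_eq_empty.1 hemp)
    rw [← φ.map_bot, (φ.toEquiv X).injective.eq_iff] at h₁
    have h₂ : μ ∈ A.1 := mem_atomOf_self μ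
    rw [h₁] at h₂
    exact h₂
  obtain ⟨ν, hν⟩ := hne
  have key : ∀ D : (R f₁).carrier X, μ ∈ D.1 → ν ∈ (φ.toEquiv X D).1 := by
    intro D hD
    have h₁ : (R f₁).inf A D = A := Subtype.ext <| Set.inter_eq_left.2 fun ρ hρ =>
      hρ _ ⟨definable_iff_mem_range.2 D.2, hD⟩
    have h₂ := φ.map_inf A D
    rw [h₁] at h₂
    rw [h₂] at hν
    exact hν.2
  refine ⟨ν, fun D => ⟨key D, fun hD => ?_⟩⟩
  by_contra hμ
  have := key ((R f₁).compl D) hμ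
  rw [φ.map_compl] at this
  exact this hD

/-- `φ` preserves the sets `p ≡ q`, so a surjective `μ` and its corresponding point have the same
kernel. -/
theorem exists_injective_hom [Finite Γ] (hG₁ : ∀ i, Finite (G₁ i)) (φ : (R f₁).Iso (R f₂)) :
    ∃ (X : Place Θ) (μ : Point X G₁) (j : Hom G₁ G₂), (∀ i, Function.Surjective (μ.toFun i)) ∧
      (∀ i, Function.Injective (j.toFun i)) ∧
      ∀ D : (R f₁).carrier X, μ ∈ D.1 ↔ j.comp μ ∈ (φ.toEquiv X D).1 := by
  obtain ⟨X, μ, -, hμ, -⟩ := exists_surjective_point hG₁ ∅ fun _ => (G₁.nonempty _).some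
  obtain ⟨ν, hν⟩ := exists_corresponding_point hG₁ φ μ
  obtain ⟨j, hj, rfl⟩ := exists_injective_hom_of_ker_eq μ ν hμ fun i p q => by
    have := hν ((R f₁).eq p q)
    rw [φ.map_eq] at this
    exact this
  exact ⟨X, μ, j, hμ, hj, hν⟩

theorem exists_corresponding_iso [Finite Γ] (hG₁ : ∀ i, Finite (G₁ i)) (hG₂ : ∀ i, Finite (G₂ i))
    (φ : (R f₁).Iso (R f₂)) :
    ∃ (X : Place Θ) (μ : Point X G₁) (δ : Iso G₁ G₂), (∀ i, Function.Surjective (μ.toFun i)) ∧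
      ∀ D : (R f₁).carrier X, μ ∈ D.1 ↔ δ.toHom.comp μ ∈ (φ.toEquiv X D).1 := by
  obtain ⟨X, μ, j, hμ, hj, h⟩ := exists_injective_hom hG₁ φ
  -- The reverse embedding serves only to compare cardinalities sort by sort.
  obtain ⟨-, -, j', -, hj', -⟩ := exists_injective_hom hG₂ φ.symm
  exact ⟨X, μ, Iso.ofBijective j fun i =>
    (hj i).bijective_of_nat_card_le (Nat.card_le_card_of_injective _ (hj' i)), hμ, h⟩

/-- Writing `σ μ = μ s`, the condition `σ μ ∈ D` becomes `μ ∈ s_* D`, a statement inside `R f₁` that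
`φ` carries to `R f₂`. Hence `σ` preserves all formulas at `μ` exactly when `δ σ δ⁻¹` does at `δ μ`.
-/
theorem modelAutEquivalent_of_iso [Finite Γ] (hG₁ : ∀ i, Finite (G₁ i))
    (hG₂ : ∀ i, Finite (G₂ i)) (φ : (R f₁).Iso (R f₂)) : ModelAutEquivalent f₁ f₂ := by
  obtain ⟨X, μ, δ, hμ, h⟩ := exists_corresponding_iso hG₁ hG₂ φ
  have hν : ∀ i, Function.Surjective ((δ.toHom.comp μ).toFun i) := fun i =>
    (δ.toEquiv i).surjective.comp (hμ i)
  have key : ∀ σ : Iso G₁ G₁, σ ∈ modelAut f₁ ↔ (δ.symm.trans σ).trans δ ∈ modelAut f₂ := by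
    intro σ
    obtain ⟨s, hs⟩ := exists_comp_eq μ hμ (σ.toHom.comp μ)
    have hτ : ((δ.symm.trans σ).trans δ).toHom.comp (δ.toHom.comp μ) =
        (δ.toHom.comp μ).comp s := by
      change _ = δ.toHom.comp (μ.comp s)
      rw [hs]
      ext i p
      exact congrArg (fun g => δ.toEquiv i (σ.toEquiv i g)) ((δ.toEquiv i).symm_apply_apply _)
    have hR : ∀ D : (R f₁).carrier X, (μ ∈ D.1 ↔ σ.toHom.comp μ ∈ D.1) ↔
        (δ.toHom.comp μ ∈ (φ.toEquiv X D).1 ↔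
          ((δ.symm.trans σ).trans δ).toHom.comp (δ.toHom.comp μ) ∈ (φ.toEquiv X D).1) := by
      intro D
      have h₁ := h ((R f₁).sub s D)
      rw [φ.map_sub] at h₁
      rw [hτ, ← hs, h D]
      exact iff_congr Iff.rfl h₁
    constructor
    · intro hσ
      refine IsModelIso.of_mem_val_iff _ hν fun p => ?_
      -- By surjectivity of `φ`, each value of a formula over `Φ₂` comes from a definable set of
      -- `f₁`.
      obtain ⟨D, hD⟩ := (φ.toEquiv X).surjective ⟨p.val f₂, Quot.mk _ p, rfl⟩
      have h₂ := hR D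
      rw [hD] at h₂
      refine h₂.1 ?_
      obtain ⟨⟨q⟩, hq⟩ := D.2
      rw [← hq]
      exact IsModelIso.mem_val_iff hσ q μ
    · intro hτ'
      refine IsModelIso.of_mem_val_iff _ hμ fun p => ?_
      refine (hR ⟨p.val f₁, Quot.mk _ p, rfl⟩).2 ?_
      obtain ⟨⟨q⟩, hq⟩ := (φ.toEquiv X ⟨p.val f₁, Quot.mk _ p, rfl⟩).2
      rw [← hq]
      exact IsModelIso.mem_val_iff hτ' q _
  refine ⟨δ.symm, Set.ext fun τ => ⟨fun hτ => ?_, ?_⟩⟩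
  · have hτ' : (δ.symm.trans ((δ.trans τ).trans δ.symm)).trans δ = τ :=
      Iso.ext' fun i g => by simp [Iso.trans, Iso.symm]
    exact ⟨(δ.trans τ).trans δ.symm, (key _).2 (by rwa [hτ']), hτ'⟩
  · rintro ⟨σ, hσ, rfl⟩
    exact (key σ).1 hσ

end

theorem KIso.exists_isModelIso [Finite Γ] {Φ : RelSig.{u, b} Γ} {G₁ : Alg.{u, v, a, w₁} Θ}
    {G₂ : Alg.{u, v, a, w₂} Θ} {f₁ : Realization Φ G₁} {f₂ : Realization Φ G₂}
    (hG₁ : ∀ i, Finite (G₁ i)) (hG₂ : ∀ i, Finite (G₂ i)) (γ : KIso f₁ f₂) (hγ : γ.Correct) :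
    ∃ δ : Iso G₁ G₂, IsModelIso f₁ f₂ δ := by
  obtain ⟨X, μ, δ, hμ, h⟩ := exists_corresponding_iso hG₁ hG₂ γ.onR
  refine ⟨δ, IsModelIso.of_mem_val_iff μ hμ fun p => ?_⟩
  have e := (γ.onSet_eq_onR X (Quot.mk _ p)).symm.trans (congrArg Subtype.val (hγ X _))
  exact (h ⟨_, Quot.mk _ p, rfl⟩).trans (iff_of_eq (congrArg (δ.toHom.comp μ ∈ ·) e))

/-! ### From isomorphisms of algebras to isomorphisms of weak categories -/

/-- The set of points over `G₂` that an isomorphism `δ : G₂ → G₁` maps into `A`. -/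
def pull {G₁ : Alg.{u, v, a, w₁} Θ} {G₂ : Alg.{u, v, a, w₂} Θ} (δ : Iso G₂ G₁) {X : Place Θ}
    (A : Set (Point X G₁)) : Set (Point X G₂) :=
  {ν | δ.toHom.comp ν ∈ A}

theorem pull_symm_pull {G₁ : Alg.{u, v, a, w₁} Θ} {G₂ : Alg.{u, v, a, w₂} Θ} (δ : Iso G₂ G₁)
    {X : Place Θ} (A : Set (Point X G₁)) : pull δ.symm (pull δ A) = A :=
  Set.ext fun μ => iff_of_eq (congrArg (· ∈ A) (δ.comp_symm_comp μ))

theorem pull_pull_symm {G₁ : Alg.{u, v, a, w₁} Θ} {G₂ : Alg.{u, v, a, w₂} Θ} (δ : Iso G₂ G₁)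
    {X : Place Θ} (A : Set (Point X G₂)) : pull δ (pull δ.symm A) = A :=
  pull_symm_pull δ.symm A

theorem pull_exSet {G₁ : Alg.{u, v, a, w₁} Θ} {G₂ : Alg.{u, v, a, w₂} Θ} (δ : Iso G₂ G₁)
    {X : Place Θ} (x : X.V) (A : Set (Point X G₁)) :
    pull δ (exSet x A) = exSet x (pull δ A) := by
  refine Set.ext fun μ => ⟨?_, ?_⟩
  · rintro ⟨ν, hν, h⟩
    refine ⟨δ.symm.toHom.comp ν, ?_, fun y hy => (Equiv.eq_symm_apply _).2 (h y hy)⟩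
    change δ.toHom.comp (δ.symm.toHom.comp ν) ∈ A
    rwa [δ.comp_symm_comp]
  · rintro ⟨ν, hν, h⟩
    exact ⟨_, hν, fun y hy => congrArg (δ.toEquiv _) (h y hy)⟩

section

variable {Φ₁ : RelSig.{u, b₁} Γ} {Φ₂ : RelSig.{u, b₂} Γ} {G₁ : Alg.{u, v, a, w₁} Θ}
  {G₂ : Alg.{u, v, a, w₂} Θ} {f₁ : Realization Φ₁ G₁} {f₂ : Realization Φ₂ G₂}

/-- Pulling back and forth returns an object equal, but not definitionally equal, to the original;
morphisms are then compared through their underlying homomorphisms. -/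
theorem K.hom_heq {P P' Q Q' : K f₁} (hP : P = P') (hQ : Q = Q') (s : P ⟶ Q) (t : P' ⟶ Q')
    (h : HEq s.1 t.1) : HEq s t := by
  subst hP hQ
  exact heq_of_eq (Subtype.ext (eq_of_heq h))

/-- The functor of weak categories that pulls algebraic sets back along an isomorphism of
algebras. -/
noncomputable def pullFunctor (δ : Iso G₂ G₁)
    (h : ∀ (X : Place Θ) (A : AlgSet f₁ X), ∃ T : Set (Hal Θ Φ₂ X), pull δ A.1 = locus f₂ T) :
    K f₁ ⥤ K f₂ where
  obj P := ⟨P.place, pull δ P.set.1, h _ P.set⟩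
  -- Substitution acts on the right of a point and `δ` on the left, so `s` itself need not change.
  map s := ⟨s.1, fun _ hν => s.2 _ hν⟩

theorem pullFunctor_comp (δ : Iso G₂ G₁)
    (h : ∀ (X : Place Θ) (A : AlgSet f₁ X), ∃ T : Set (Hal Θ Φ₂ X), pull δ A.1 = locus f₂ T)
    (h' : ∀ (X : Place Θ) (A : AlgSet f₂ X),
      ∃ T : Set (Hal Θ Φ₁ X), pull δ.symm A.1 = locus f₁ T) :
    pullFunctor δ h ⋙ pullFunctor δ.symm h' = 𝟭 (K f₁) := by
  have hobj : ∀ P, (pullFunctor δ h ⋙ pullFunctor δ.symm h').obj P = P := by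
    rintro ⟨X, A, hA⟩
    simp only [Functor.comp_obj, pullFunctor, pull_symm_pull]
  exact CategoryTheory.Functor.hext hobj fun P Q s => K.hom_heq (hobj P) (hobj Q) _ _ HEq.rfl

/-- An isomorphism of finite algebras that matches the definable sets yields an isomorphism of
the weak categories. -/
noncomputable def KIso.ofIso (hG₁ : ∀ i, Finite (G₁ i)) (hG₂ : ∀ i, Finite (G₂ i))
    (δ : Iso G₂ G₁)
    (h : ∀ (X : Place Θ) (A : Set (Point X G₁)), Definable f₁ A ↔ Definable f₂ (pull δ A)) :
    KIso f₁ f₂ :=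
  have h₁ : ∀ (X : Place Θ) (A : AlgSet f₁ X),
      ∃ T : Set (Hal Θ Φ₂ X), pull δ A.1 = locus f₂ T := fun X A =>
    (definable_iff_algebraic hG₂).1 ((h X _).1 ((definable_iff_algebraic hG₁).2 A.2))
  have h' : ∀ (X : Place Θ) (A : Set (Point X G₂)),
      Definable f₂ A ↔ Definable f₁ (pull δ.symm A) := fun X A => by
    rw [h, pull_pull_symm]
  have h₂ : ∀ (X : Place Θ) (A : AlgSet f₂ X),
      ∃ T : Set (Hal Θ Φ₁ X), pull δ.symm A.1 = locus f₁ T := fun X A =>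
    (definable_iff_algebraic hG₁).1 ((h' X _).1 ((definable_iff_algebraic hG₂).2 A.2))
  { functor := pullFunctor δ h₁
    inv := pullFunctor δ.symm h₂
    functor_inv := pullFunctor_comp δ h₁ h₂
    inv_functor := pullFunctor_comp δ.symm h₂ h₁
    onSet X A := ⟨pull δ A.1, h₁ X A⟩
    obj_eq _ _ := rfl
    subset_iff X A B := by
      refine ⟨fun hAB => ?_, fun hAB _ hν => hAB hν⟩
      rw [← pull_symm_pull δ A.1, ← pull_symm_pull δ B.1]
      exact fun _ hν => hAB hν
    onR :=
      { toEquiv X :=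
          { toFun A := ⟨pull δ A.1, definable_iff_mem_range.1
              ((h X _).1 (definable_iff_mem_range.2 A.2))⟩
            invFun A := ⟨pull δ.symm A.1, definable_iff_mem_range.1
              ((h' X _).1 (definable_iff_mem_range.2 A.2))⟩
            left_inv A := Subtype.ext (pull_symm_pull δ A.1)
            right_inv A := Subtype.ext (pull_pull_symm δ A.1) }
        map_bot _ := rfl
        map_top _ := rfl
        map_sup _ _ := rfl
        map_inf _ _ := rfl
        map_compl _ := rfl
        map_ex x A := Subtype.ext (pull_exSet δ x A.1)
        map_eq p q := Subtype.ext (Set.ext fun _ => (δ.toEquiv _).injective.eq_iff)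
        map_sub _ _ := rfl }
    onSet_eq_onR _ _ := rfl }

/-- Conjugate groups have corresponding invariant sets, and by `definable_iff_invariant` these are
the definable ones. -/
theorem ModelAutEquivalent.nonempty_kIso [Finite Γ] (hG₁ : ∀ i, Finite (G₁ i))
    (hG₂ : ∀ i, Finite (G₂ i)) (h : ModelAutEquivalent f₁ f₂) : Nonempty (KIso f₁ f₂) := by
  obtain ⟨δ, hδ⟩ := h
  refine ⟨KIso.ofIso hG₁ hG₂ δ fun X A => ?_⟩
  rw [definable_iff_invariant hG₁, definable_iff_invariant hG₂, hδ]
  have hcomp : ∀ (σ : Iso G₁ G₁) (ν : Point X G₂),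
      δ.toHom.comp (((δ.trans σ).trans δ.symm).toHom.comp ν) = σ.toHom.comp (δ.toHom.comp ν) :=
    fun σ ν => δ.comp_symm_comp (σ.toHom.comp (δ.toHom.comp ν))
  constructor
  · rintro hA _ ⟨σ, hσ, rfl⟩ ν hν
    change _ ∈ A
    rw [hcomp]
    exact hA σ hσ _ hν
  · intro hA σ hσ μ hμ
    have hν : δ.symm.toHom.comp μ ∈ pull δ A := by
      change _ ∈ A
      rwa [δ.comp_symm_comp]
    have h₁ : _ ∈ A := hA _ ⟨σ, hσ, rfl⟩ _ hν
    rwa [hcomp, δ.comp_symm_comp] at h₁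

end

theorem IsModelIso.symm {Φ : RelSig.{u, b} Γ} {G₁ : Alg.{u, v, a, w₁} Θ}
    {G₂ : Alg.{u, v, a, w₂} Θ} {f₁ : Realization Φ G₁} {f₂ : Realization Φ G₂} {δ : Iso G₁ G₂}
    (h : IsModelIso f₁ f₂ δ) : IsModelIso f₂ f₁ δ.symm := by
  intro r t
  rw [h]
  simp [Iso.symm]

section

variable {Φ : RelSig.{u, b} Γ} {G₁ : Alg.{u, v, a, w₁} Θ} {G₂ : Alg.{u, v, a, w₂} Θ}
  {f₁ : Realization Φ G₁} {f₂ : Realization Φ G₂}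

theorem IsModelIso.pull_val {δ : Iso G₁ G₂} (h : IsModelIso f₁ f₂ δ) {X : Place Θ}
    (p : Hal Θ Φ X) : pull δ.symm (Val f₁ p) = Val f₂ p := by
  obtain ⟨p⟩ := p
  exact Set.ext fun μ => (h.symm.mem_val_iff p μ).symm

theorem IsModelIso.pull_locus {δ : Iso G₁ G₂} (h : IsModelIso f₁ f₂ δ) {X : Place Θ}
    (T : Set (Hal Θ Φ X)) : pull δ.symm (locus f₁ T) = locus f₂ T := by
  refine Set.ext fun μ => ?_
  simp only [locus, Set.mem_iInter, ← h.pull_val, pull, Set.mem_ofPred_eq]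

theorem IsModelIso.exists_kIso (hG₁ : ∀ i, Finite (G₁ i)) (hG₂ : ∀ i, Finite (G₂ i))
    {δ : Iso G₁ G₂} (h : IsModelIso f₁ f₂ δ) :
    ∃ γ : KIso f₁ f₂, γ.Correct ∧ ∀ (X : Place Θ) (T : Set (Hal Θ Φ X)),
      γ.functor.obj ⟨X, locus f₁ T, T, rfl⟩ = ⟨X, locus f₂ T, T, rfl⟩ := by
  refine ⟨KIso.ofIso hG₁ hG₂ δ.symm fun X A => ⟨?_, ?_⟩, fun X p => ?_, fun X T => ?_⟩
  · rintro ⟨p, rfl⟩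
    exact ⟨p, (h.pull_val (Quot.mk _ p)).symm⟩
  · rintro ⟨p, hp⟩
    refine ⟨p, ?_⟩
    rw [← pull_pull_symm δ A, ← hp]
    exact (h.symm.pull_val (Quot.mk _ p)).symm
  · exact Subtype.ext (h.pull_val p)
  · simp only [KIso.ofIso, pullFunctor, h.pull_locus]

end

/-! ### Isomorphisms of knowledge bases -/

/-- A fully faithful functor that is bijective on objects has a strict inverse. -/
theorem exists_strict_inverse {C : Type*} {D : Type*} [Category C] [Category D] (E : C ⥤ D)
    [E.Full] [E.Faithful] (hE : Function.Bijective E.obj) :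
    ∃ E' : D ⥤ C, E ⋙ E' = 𝟭 C ∧ E' ⋙ E = 𝟭 D := by
  choose r hr using hE.2
  let E' : D ⥤ C :=
    { obj := r
      -- `E.obj (r d)` equals `d` only propositionally, hence the transports on both sides.
      map {d d'} g := E.preimage (eqToHom (hr d) ≫ g ≫ eqToHom (hr d').symm)
      map_id d := E.map_injective (by simp)
      map_comp g g' := E.map_injective (by simp) }
  refine ⟨E', CategoryTheory.Functor.ext (fun c => hE.1 (hr _)) fun c c' g => E.map_injective ?_,
    CategoryTheory.Functor.ext hr fun d d' g => ?_⟩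
  · simp [E', eqToHom_map]
  · simp [E']

/-- Conjugation by the `γ f` is functorial and fully faithful because their inverses are strict, and
it is bijective on objects because `α` is. Correctness concerns single formulas; `hlocus` is what
keeps conjugates compatible with arbitrary sets `T`. -/
theorem kbIsomorphic_of_kIso {Φ : RelSig.{u, b} Γ} {M₁ : Multimodel.{u, v, a, b, w₁} Θ Φ}
    {M₂ : Multimodel.{u, v, a, b, w₂} Θ Φ} (α : M₁.F ≃ M₂.F)
    (γ : ∀ f : M₁.F, KIso f.1 (α f).1) (hγ : ∀ f, (γ f).Correct)
    (hlocus : ∀ (f : M₁.F) (X : Place Θ) (T : Set (Hal Θ Φ X)),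
      (γ f).functor.obj ⟨X, locus f.1 T, T, rfl⟩ = ⟨X, locus (α f).1 T, T, rfl⟩) :
    KBIsomorphic M₁ M₂ := by
  have hinv : ∀ (f : M₁.F) (X : Place Θ) (T : Set (Hal Θ Φ X)),
      (γ f).inv.obj ⟨X, locus (α f).1 T, T, rfl⟩ = ⟨X, locus f.1 T, T, rfl⟩ := fun f X T => by
    rw [← hlocus]
    exact Functor.congr_obj (γ f).functor_inv _
  let E : KB M₁ ⥤ KB M₂ :=
    { obj P := ⟨α P.inst⟩
      map {P Q} g := KB.Mor.mk ((γ P.inst).inv ⋙ KB.Mor.functor g ⋙ (γ Q.inst).functor)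
        fun X T => by
          simp only [Functor.comp_obj]
          rw [hinv, KB.Mor.map_locus g, hlocus]
      map_id P := KB.Mor.ext (γ P.inst).inv_functor
      map_comp {P Q S} g h := KB.Mor.ext <| by
        -- The inserted identity is then expanded as `γ` followed by its inverse at the middle
        -- object.
        change (γ P.inst).inv ⋙ (KB.Mor.functor g ⋙ 𝟭 _ ⋙ KB.Mor.functor h) ⋙
          (γ S.inst).functor = _
        rw [← (γ Q.inst).functor_inv]
        rfl }
  have hmap : ∀ {P Q : KB M₁} (g : P ⟶ Q), KB.Mor.functor (E.map g) =
      (γ P.inst).inv ⋙ KB.Mor.functor g ⋙ (γ Q.inst).functor := fun _ => rfl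
  have hfaithful : E.Faithful := ⟨fun {P Q g h} hgh => KB.Mor.ext <| by
    have h₁ := congrArg (fun k => (γ P.inst).functor ⋙ KB.Mor.functor k ⋙ (γ Q.inst).inv) hgh
    have h₂ : ∀ k : P ⟶ Q, (γ P.inst).functor ⋙ KB.Mor.functor (E.map k) ⋙ (γ Q.inst).inv =
        KB.Mor.functor k := fun k => by
      change ((γ P.inst).functor ⋙ (γ P.inst).inv) ⋙ KB.Mor.functor k ⋙
        ((γ Q.inst).functor ⋙ (γ Q.inst).inv) = _
      rw [(γ P.inst).functor_inv, (γ Q.inst).functor_inv]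
      rfl
    exact (h₂ g).symm.trans (h₁.trans (h₂ h))⟩
  have hfull : E.Full := ⟨fun {P Q} g => by
    refine ⟨KB.Mor.mk ((γ P.inst).functor ⋙ KB.Mor.functor g ⋙ (γ Q.inst).inv)
      fun X T => ?_, KB.Mor.ext ?_⟩
    · simp only [Functor.comp_obj]
      rw [hlocus, ← hinv]
      exact congrArg _ (KB.Mor.map_locus g X T)
    · change ((γ P.inst).inv ⋙ (γ P.inst).functor) ⋙ KB.Mor.functor g ⋙
        ((γ Q.inst).inv ⋙ (γ Q.inst).functor) = _
      rw [(γ P.inst).inv_functor, (γ Q.inst).inv_functor]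
      rfl⟩
  have hobj : Function.Bijective E.obj := by
    refine ⟨fun P Q h => ?_, fun P => ⟨⟨α.symm P.inst⟩, ?_⟩⟩
    · exact congrArg KB.mk (α.injective (congrArg KB.inst h))
    · exact congrArg KB.mk (α.apply_symm_apply _)
  obtain ⟨E', h₁, h₂⟩ := exists_strict_inverse E hobj
  exact ⟨E, E', fun P => γ P.inst, h₁, h₂, fun P => hγ _, fun _ _ g => hmap g⟩

end KnowledgeBase

open KnowledgeBase in
theorem mainTheorem12 {Γ : Type u} [Finite Γ]
    (Θ : Variety.{u, v, a} Γ)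
    (G₁ : Alg.{u, v, a, w₁} Θ) (G₂ : Alg.{u, v, a, w₂} Θ)
    (hG₁ : ∀ i, Finite (G₁ i)) (hG₂ : ∀ i, Finite (G₂ i)) :
    (∀ (Φ₁ : RelSig.{u, b₁} Γ) (Φ₂ : RelSig.{u, b₂} Γ)
      (F₁ : Set (Realization Φ₁ G₁)) (F₂ : Set (Realization Φ₂ G₂)),
      KBEquivalent ⟨G₁, F₁⟩ ⟨G₂, F₂⟩ ↔ AutEquivalent ⟨G₁, F₁⟩ ⟨G₂, F₂⟩) ∧
    (∀ (Φ : RelSig.{u, b₁} Γ)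
      (F₁ : Set (Realization Φ G₁)) (F₂ : Set (Realization Φ G₂)),
      KBIsomorphic ⟨G₁, F₁⟩ ⟨G₂, F₂⟩ ↔ Multimodel.Isomorphic ⟨G₁, F₁⟩ ⟨G₂, F₂⟩) := by
  refine ⟨fun Φ₁ Φ₂ F₁ F₂ => ⟨?_, ?_⟩, fun Φ F₁ F₂ => ⟨?_, ?_⟩⟩
  · rintro ⟨α, h⟩
    exact ⟨α, fun f => (h f).elim fun γ => modelAutEquivalent_of_iso hG₁ hG₂ γ.onR⟩
  · rintro ⟨α, h⟩
    exact ⟨α, fun f => (h f).nonempty_kIso hG₁ hG₂⟩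
  · rintro ⟨E, E', γ, h₁, h₂, hγ, -⟩
    -- The object maps of the two inverse functors form the bijection of instances.
    exact ⟨⟨fun f => (E.obj ⟨f⟩).inst, fun f => (E'.obj ⟨f⟩).inst,
      fun f => congrArg KB.inst (Functor.congr_obj h₁ ⟨f⟩),
      fun f => congrArg KB.inst (Functor.congr_obj h₂ ⟨f⟩)⟩,
      fun f => (γ ⟨f⟩).exists_isModelIso hG₁ hG₂ (hγ ⟨f⟩)⟩
  · rintro ⟨α, h⟩
    choose δ hδ using h
    choose γ hγ hlocus using fun f => (hδ f).exists_kIso hG₁ hG₂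
    exact kbIsomorphic_of_kIso α γ hγ hlocus
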